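/- For $\theta\in\mathbb R$ and $k\ge 1$ let $$\widetilde\nu_{k}=\widetilde\nu_{k,\theta}:=\tfrac13\left[\delta_{3^{-k}\cos(\pi/2-\theta)}+\delta_{3^{-k}\cos(-\pi/6-\theta)}+\delta_{3^{-k}\cos(7\pi/6-\theta)}\right],$$ let $\nu_n=\nu_{n,\theta}:=\widetilde\nu_1*\cdots*\widetilde\nu_n$ (with $\nu_0=\delta_0$), and let $$f_{n,\theta}:=\tfrac12\,\nu_n*\left(3^n\chi_{[-3^{-n},3^{-n}]}\right),\qquad f^*_{N,\theta}:=\max_{0\le n\le N}f_{n,\theta}.$$ Theorem. Let $0<\varepsilon_0<1/11$. For a positive integer $N$ put $K:=N^{\varepsilon_0}$ and $$E_N:=\left\{\theta\in[0,\pi):\ \left|\{x\in\mathbb R: f^*_{N,\theta}(x)\ge K\}\right|\le K^{-3}\right\},$$ where $|\cdot|$ is Lebesgue measure. Then there is $N_0=N_0(\varepsilon_0)$ such that $|E_N|<N^{-\varepsilon_0}$ for all $N\ge N_0$. -/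

import Mathlib

open MeasureTheory Filter
open scoped ENNReal

noncomputable section

namespace Gasket

/-- The measure `ν̃_k` (depending on the direction `θ`): one third of the sum of the Dirac masses
at the projections of the three points `3^{-k} e^{iπ/2}`, `3^{-k} e^{-iπ/6}`, `3^{-k} e^{7iπ/6}`. -/
def stepMeasure (θ : ℝ) (k : ℕ) : Measure ℝ :=
  (3 : ℝ≥0∞)⁻¹ •
    (Measure.dirac ((3 : ℝ)⁻¹ ^ k * Real.cos (Real.pi / 2 - θ)) +
      Measure.dirac ((3 : ℝ)⁻¹ ^ k * Real.cos (-Real.pi / 6 - θ)) +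
      Measure.dirac ((3 : ℝ)⁻¹ ^ k * Real.cos (7 * Real.pi / 6 - θ)))

/-- The measure `ν_n`, the convolution of `ν̃_1, …, ν̃_n`
(the empty convolution being the unit mass at `0`). -/
def nu (θ : ℝ) : ℕ → Measure ℝ
  | 0 => Measure.dirac 0
  | n + 1 => Measure.conv (nu θ n) (stepMeasure θ (n + 1))

/-- The projection multiplicity function
`f_{n,θ} = (1/2) ν_n * 3^n χ_{[-3^{-n}, 3^{-n}]}`. -/
def multiplicity (n : ℕ) (θ x : ℝ) : ℝ :=
  (1 / 2) * ∫ y, (3 : ℝ) ^ n *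
    (Set.Icc (-(3 : ℝ)⁻¹ ^ n) ((3 : ℝ)⁻¹ ^ n)).indicator (fun _ => (1 : ℝ)) (x - y) ∂(nu θ n)

/-- The maximal multiplicity function `f*_{N,θ} = max_{n ≤ N} f_{n,θ}`. -/
def maxMultiplicity (N : ℕ) (θ x : ℝ) : ℝ :=
  (Finset.range (N + 1)).sup' Finset.nonempty_range_add_one (fun n => multiplicity n θ x)

/-- The set `A*_{K,N,θ} = {x : f*_{N,θ}(x) ≥ K}`. -/
def maxMultiplicitySet (K : ℝ) (N : ℕ) (θ : ℝ) : Set ℝ :=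
  {x | K ≤ maxMultiplicity N θ x}

/-- The set of directions `θ ∈ [0, π)` with `|A*_{K,N,θ}| ≤ K^{-3}`. -/
def directionSet (K : ℝ) (N : ℕ) : Set ℝ :=
  {θ | θ ∈ Set.Ico 0 Real.pi ∧
    volume (maxMultiplicitySet K N θ) ≤ ENNReal.ofReal ((K ^ 3)⁻¹)}

end Gasket

end

noncomputable section

namespace Gasket

/-- The point with ternary address `w` in the self-similar set on the line generated by the
translations `c`. -/
def pt (c : Fin 3 → ℝ) {n : ℕ} (w : Fin n → Fin 3) : ℝ :=
  ∑ i : Fin n, (3 : ℝ)⁻¹ ^ ((i : ℕ) + 1) * c (w i)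

/-- The number of words of length `n` whose interval of radius `3⁻ⁿ` covers `x`. -/
def cnt (c : Fin 3 → ℝ) (n : ℕ) (x : ℝ) : ℕ :=
  (Finset.univ.filter fun w : Fin n → Fin 3 => |3 ^ n * (x - pt c w)| ≤ 1).card

/-- The number of words of length `n` whose interval of radius `3⁻ⁿ` meets the `j`-th triadic
interval of length `3⁻ⁿ`. -/
def cellCnt (c : Fin 3 → ℝ) (n : ℕ) (j : ℤ) : ℕ :=
  (Finset.univ.filter fun w : Fin n → Fin 3 =>
    (j : ℝ) - 1 ≤ 3 ^ n * pt c w ∧ 3 ^ n * pt c w ≤ j + 2).card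

variable {c : Fin 3 → ℝ}

lemma pt_append {k j : ℕ} (w : Fin k → Fin 3) (v : Fin j → Fin 3) :
    pt c (Fin.append w v) = pt c w + (3 : ℝ)⁻¹ ^ k * pt c v := by
  simp only [pt, Fin.sum_univ_add, Fin.append_left, Fin.append_right, Fin.val_castAdd,
    Fin.val_natAdd, Finset.mul_sum]
  congr 1
  refine Finset.sum_congr rfl fun i _ => ?_
  ring

lemma abs_pt_le (hc : ∀ i, |c i| ≤ 1) {n : ℕ} (w : Fin n → Fin 3) :
    |pt c w| ≤ (1 - (3 : ℝ)⁻¹ ^ n) / 2 := by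
  calc |pt c w| ≤ ∑ i : Fin n, |(3 : ℝ)⁻¹ ^ ((i : ℕ) + 1) * c (w i)| :=
        Finset.abs_sum_le_sum_abs _ _
    _ ≤ ∑ i : Fin n, (3 : ℝ)⁻¹ ^ ((i : ℕ) + 1) := by
        refine Finset.sum_le_sum fun i _ => ?_
        rw [abs_mul, abs_of_pos (by positivity)]
        exact mul_le_of_le_one_right (by positivity) (hc _)
    _ = (1 - (3 : ℝ)⁻¹ ^ n) / 2 := by
        rw [Fin.sum_univ_eq_sum_range (fun i => (3 : ℝ)⁻¹ ^ (i + 1))]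
        clear w
        induction n with
        | zero => simp
        | succ n ih => rw [Finset.sum_range_succ, ih]; ring

lemma sum_append {M : Type*} [AddCommMonoid M] (k j : ℕ) (f : (Fin (k + j) → Fin 3) → M) :
    ∑ w, f w = ∑ w : Fin k → Fin 3, ∑ v : Fin j → Fin 3, f (Fin.append w v) := by
  rw [← (Fin.appendEquiv k j).sum_comp, Fintype.sum_prod_type]
  rfl

lemma cnt_eq_sum (n : ℕ) (x : ℝ) :
    cnt c n x = ∑ w : Fin n → Fin 3, if |3 ^ n * (x - pt c w)| ≤ 1 then 1 else 0 := by
  rw [cnt, Finset.card_filter]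

lemma cnt_add (k j : ℕ) (x : ℝ) :
    cnt c (k + j) x = ∑ w : Fin k → Fin 3, cnt c j (3 ^ k * (x - pt c w)) := by
  simp only [cnt_eq_sum, sum_append, pt_append]
  refine Finset.sum_congr rfl fun w _ => Finset.sum_congr rfl fun v _ => ?_
  have : (3 : ℝ) ^ (k + j) * (x - (pt c w + 3⁻¹ ^ k * pt c v)) =
      3 ^ j * (3 ^ k * (x - pt c w) - pt c v) := by
    rw [inv_pow, pow_add]
    field_simp
    ring
  rw [this]

lemma cnt_eq_zero (hc : ∀ i, |c i| ≤ 1) {n : ℕ} {x : ℝ} (hx : 1 < |x|) : cnt c n x = 0 := by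
  rw [cnt, Finset.card_eq_zero, Finset.filter_eq_empty_iff]
  intro w _ h
  have h1 := abs_pt_le hc w
  have h2 : |x| - |pt c w| ≤ |x - pt c w| := abs_sub_abs_le_abs_sub _ _
  rw [abs_mul, abs_of_pos (by positivity : (0 : ℝ) < 3 ^ n)] at h
  have h3 : (1 : ℝ) ≤ 3 ^ n := one_le_pow₀ (by norm_num)
  have h4 : (3 : ℝ) ^ n * 3⁻¹ ^ n = 1 := by rw [← mul_pow]; norm_num
  have h5 : (0 : ℝ) < 3⁻¹ ^ n := by positivity
  have h6 : (1 + (3 : ℝ)⁻¹ ^ n) / 2 < |x - pt c w| := by linarith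
  nlinarith

lemma cnt_sq_le (hc : ∀ i, |c i| ≤ 1) (k j : ℕ) (x : ℝ) :
    cnt c (k + j) x ^ 2 ≤
      cnt c k x * ∑ w : Fin k → Fin 3, cnt c j (3 ^ k * (x - pt c w)) ^ 2 := by
  have h : ∀ w : Fin k → Fin 3, w ∉ (Finset.univ.filter fun w : Fin k → Fin 3 =>
      |3 ^ k * (x - pt c w)| ≤ 1) → cnt c j (3 ^ k * (x - pt c w)) = 0 := by
    intro w hw
    apply cnt_eq_zero hc
    simpa using hw
  rw [cnt_add, ← Finset.sum_subset (Finset.subset_univ _) (fun w _ hw => h w hw),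
    ← Finset.sum_subset (Finset.subset_univ _) (fun w _ hw => by rw [h w hw]; rfl)]
  exact sq_sum_le_card_mul_sum_sq

lemma cnt_le_cellCnt (n : ℕ) (x : ℝ) : cnt c n x ≤ cellCnt c n ⌊3 ^ n * x⌋ := by
  refine Finset.card_le_card fun w hw => ?_
  simp only [Finset.mem_filter, Finset.mem_univ, true_and, abs_le] at hw ⊢
  have h1 := Int.floor_le (3 ^ n * x)
  have h2 := Int.lt_floor_add_one (3 ^ n * x)
  constructor <;> linarith

lemma cellCnt_succ_le (hc : ∀ i, |c i| ≤ 1) (k : ℕ) (j : ℤ) :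
    cellCnt c (k + 1) j ≤ 3 * cellCnt c k (j / 3) := by
  rw [cellCnt, cellCnt, Finset.card_filter, Finset.card_filter, sum_append, Finset.mul_sum]
  refine Finset.sum_le_sum fun w _ => ?_
  split_ifs with h
  · refine (Finset.sum_le_card_nsmul _ _ 1 fun v _ => ?_).trans ?_
    · split_ifs <;> simp
    · simp
  · rw [mul_zero, nonpos_iff_eq_zero]
    refine Finset.sum_eq_zero fun v _ => if_neg fun hv => h ?_
    have h1 := abs_le.1 (abs_pt_le hc v)
    rw [pt_append] at hv
    have h2 : (3 : ℝ) ^ (k + 1) * (pt c w + 3⁻¹ ^ k * pt c v) =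
        3 * (3 ^ k * pt c w + pt c v) := by
      rw [inv_pow, pow_succ]
      field_simp
    rw [h2] at hv
    have h3 : 3 * ((j / 3 : ℤ) : ℝ) ≤ j := by exact_mod_cast Int.mul_ediv_self_le (by norm_num)
    have h4 : (j : ℝ) ≤ 3 * ((j / 3 : ℤ) : ℝ) + 2 := by
      have : j ≤ 3 * (j / 3) + 2 := by omega
      exact_mod_cast this
    norm_num at h1
    constructor <;> linarith

lemma exists_le_cnt_of_le_cellCnt {n : ℕ} {j : ℤ} {L : ℕ} (h : 3 * L ≤ cellCnt c n j) :
    ∃ s : ℤ, |s| ≤ 1 ∧ ∀ y : ℝ, ⌊3 ^ n * y⌋ = j + s → L ≤ cnt c n y := by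
  set A : ℤ → Finset (Fin n → Fin 3) := fun s => Finset.univ.filter fun w =>
    ((j + s : ℤ) : ℝ) ≤ 3 ^ n * pt c w ∧ 3 ^ n * pt c w ≤ ((j + s : ℤ) : ℝ) + 1 with hA
  have key : ∀ s, L ≤ (A s).card → ∀ y : ℝ, ⌊3 ^ n * y⌋ = j + s → L ≤ cnt c n y := by
    intro s hs y hy
    refine hs.trans (Finset.card_le_card fun w hw => ?_)
    have h1 := Int.floor_le (3 ^ n * y)
    have h2 := Int.lt_floor_add_one (3 ^ n * y)
    rw [hy] at h1 h2
    simp only [hA, Finset.mem_filter, Finset.mem_univ, true_and, abs_le] at hw ⊢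
    constructor <;> linarith
  have hsub : cellCnt c n j ≤ (A (-1) ∪ (A 0 ∪ A 1)).card := by
    refine Finset.card_le_card fun w hw => ?_
    simp only [hA, Finset.mem_filter, Finset.mem_univ, true_and, Finset.mem_union] at hw ⊢
    push_cast
    by_cases h1 : 3 ^ n * pt c w ≤ j
    · left; constructor <;> linarith
    · by_cases h2 : 3 ^ n * pt c w ≤ j + 1
      · right; left; constructor <;> linarith
      · right; right; constructor <;> linarith
  have h1 := Finset.card_union_le (A (-1)) (A 0 ∪ A 1)
  have h2 := Finset.card_union_le (A 0) (A 1)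
  by_cases a1 : L ≤ (A (-1)).card
  · exact ⟨-1, by norm_num, key _ a1⟩
  by_cases a2 : L ≤ (A 0).card
  · exact ⟨0, by norm_num, key _ a2⟩
  by_cases a3 : L ≤ (A 1).card
  · exact ⟨1, by norm_num, key _ a3⟩
  omega

@[fun_prop]
lemma measurable_cnt (n : ℕ) : Measurable (cnt c n) := by
  have : cnt c n = fun x => ∑ w : Fin n → Fin 3, if |3 ^ n * (x - pt c w)| ≤ 1 then 1 else 0 := by
    funext x; exact cnt_eq_sum n x
  rw [this]
  refine Finset.measurable_sum _ fun w _ => Measurable.ite ?_ measurable_const measurable_const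
  exact measurableSet_le (by fun_prop) measurable_const

lemma lintegral_comp_affine {f : ℝ → ℝ≥0∞} (hf : Measurable f) (k : ℕ) (p : ℝ) :
    ∫⁻ x, f (3 ^ k * (x - p)) = ENNReal.ofReal (3⁻¹ ^ k) * ∫⁻ x, f x := by
  rw [lintegral_sub_right_eq_self (fun x => f (3 ^ k * x)) p]
  have h := Real.map_volume_mul_left (a := 3 ^ k) (by positivity)
  rw [← lintegral_map hf (measurable_const_mul _), h, lintegral_smul_measure, smul_eq_mul,
    abs_of_pos (by positivity), inv_pow]

lemma lintegral_cnt (n : ℕ) : ∫⁻ x, (cnt c n x : ℝ≥0∞) = 2 := by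
  have h0 : ∀ x, (cnt c 0 x : ℝ≥0∞) = (Set.Icc (-1 : ℝ) 1).indicator 1 x := by
    intro x
    have : ∀ w : Fin 0 → Fin 3, pt c w = 0 := fun w => by simp [pt]
    rw [cnt_eq_sum]
    simp only [pow_zero, one_mul, Finset.univ_unique, Finset.sum_singleton, this, sub_zero,
      Set.indicator_apply, Set.mem_Icc, abs_le]
    split_ifs <;> simp
  have h1 : ∀ x, (cnt c n x : ℝ≥0∞) =
      ∑ w : Fin n → Fin 3, (cnt c 0 (3 ^ n * (x - pt c w)) : ℝ≥0∞) := by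
    intro x
    exact_mod_cast congrArg (Nat.cast (R := ℝ≥0∞)) (cnt_add (c := c) n 0 x)
  simp_rw [h1]
  rw [lintegral_finsetSum _ (fun w _ => by fun_prop)]
  have h2 : ∫⁻ x, (cnt c 0 x : ℝ≥0∞) = 2 := by
    simp_rw [h0]
    rw [lintegral_indicator_one measurableSet_Icc, Real.volume_Icc]
    norm_num
  simp_rw [lintegral_comp_affine (f := fun x => (cnt c 0 x : ℝ≥0∞)) (by fun_prop), h2]
  rw [Finset.sum_const, Finset.card_univ, Fintype.card_fun, Fintype.card_fin, Fintype.card_fin,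
    nsmul_eq_mul, ← mul_assoc, inv_pow, ENNReal.ofReal_inv_of_pos (by positivity)]
  have h3 : ENNReal.ofReal (3 ^ n) = ((3 ^ n : ℕ) : ℝ≥0∞) := by
    rw [← ENNReal.ofReal_natCast]; push_cast; rfl
  rw [h3, ENNReal.mul_inv_cancel (by positivity) (ENNReal.natCast_ne_top _), one_mul]

/-- The points lying in `A k` and in no earlier `A i`. -/
def firstAt (A : ℕ → Set ℝ) (k : ℕ) : Set ℝ := {x | x ∈ A k ∧ ∀ i < k, x ∉ A i}

/-- A set that is a union of triadic intervals of length `3⁻ᵏ`. -/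
def IsCellular (k : ℕ) (A : Set ℝ) : Prop :=
  ∀ ⦃x y : ℝ⦄, ⌊3 ^ k * x⌋ = ⌊3 ^ k * y⌋ → x ∈ A → y ∈ A

/-- The union of the triadic intervals of level `k` met by at least `3L` intervals of level `k`. -/
def crowded (c : Fin 3 → ℝ) (L k : ℕ) : Set ℝ := {x | 3 * L ≤ cellCnt c k ⌊3 ^ k * x⌋}

/-- The union of the triadic intervals of level `k` on which the multiplicity is at least `L`. -/
def full (c : Fin 3 → ℝ) (L k : ℕ) : Set ℝ :=
  {y | ∀ z : ℝ, ⌊3 ^ k * z⌋ = ⌊3 ^ k * y⌋ → L ≤ cnt c k z}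

lemma floor_pow_sub (k d : ℕ) (x : ℝ) : ⌊(3 : ℝ) ^ k * x⌋ = ⌊(3 : ℝ) ^ (k + d) * x⌋ / 3 ^ d := by
  have h := Int.floor_div_natCast ((3 : ℝ) ^ (k + d) * x) (3 ^ d)
  push_cast at h
  rw [← h, pow_add]
  congr 1
  field_simp

lemma floor_eq_of_le {k i : ℕ} (hik : i ≤ k) {x y : ℝ}
    (h : ⌊(3 : ℝ) ^ k * x⌋ = ⌊(3 : ℝ) ^ k * y⌋) : ⌊(3 : ℝ) ^ i * x⌋ = ⌊(3 : ℝ) ^ i * y⌋ := by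
  obtain ⟨d, rfl⟩ := Nat.exists_eq_add_of_le hik
  rw [floor_pow_sub i d, floor_pow_sub i d, h]

lemma IsCellular.measurableSet {k : ℕ} {A : Set ℝ} (h : IsCellular k A) : MeasurableSet A := by
  have : A = (fun x : ℝ => ⌊(3 : ℝ) ^ k * x⌋) ⁻¹' ((fun x : ℝ => ⌊(3 : ℝ) ^ k * x⌋) '' A) := by
    refine (Set.subset_preimage_image _ _).antisymm ?_
    rintro y ⟨x, hx, hxy⟩
    exact h hxy hx
  rw [this]
  exact (Int.measurable_floor.comp (measurable_const_mul _)) (Set.to_countable _).measurableSet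

lemma IsCellular.firstAt {A : ℕ → Set ℝ} (h : ∀ k, IsCellular k (A k)) (k : ℕ) :
    IsCellular k (firstAt A k) := fun _ _ hxy hx =>
  ⟨h k hxy hx.1, fun i hi hy => hx.2 i hi (h i (floor_eq_of_le hi.le hxy).symm hy)⟩

lemma isCellular_crowded (L k : ℕ) : IsCellular k (crowded c L k) := by
  intro x y hxy hx
  simpa only [crowded, Set.mem_ofPred_eq, hxy] using hx

lemma isCellular_full (L k : ℕ) : IsCellular k (full c L k) := by
  intro x y hxy hx
  simpa only [full, Set.mem_ofPred_eq, hxy] using hx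

lemma pairwise_disjoint_firstAt (A : ℕ → Set ℝ) : Pairwise (Function.onFun Disjoint (firstAt A)) := by
  intro i j hij
  refine Set.disjoint_left.2 fun x hi hj => ?_
  rcases lt_or_gt_of_ne hij with h | h
  · exact hj.2 i h hi.1
  · exact hi.2 j h hj.1

lemma exists_firstAt {A : ℕ → Set ℝ} {k : ℕ} {x : ℝ} (h : x ∈ A k) :
    ∃ i ≤ k, x ∈ firstAt A i := by
  classical
  have h' : ∃ i, x ∈ A i := ⟨k, h⟩
  exact ⟨Nat.find h', Nat.find_min' h' h, Nat.find_spec h', fun i hi => Nat.find_min h' hi⟩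

lemma cellCnt_le_of_firstAt (hc : ∀ i, |c i| ≤ 1) {L k : ℕ} (hL : 1 ≤ L) {x : ℝ}
    (hx : x ∈ firstAt (crowded c L) k) : cellCnt c k ⌊3 ^ k * x⌋ ≤ 9 * L := by
  cases k with
  | zero =>
    refine (Finset.card_le_univ _).trans ?_
    simp only [Fintype.card_fun, Fintype.card_fin, pow_zero]
    omega
  | succ k =>
    have h1 := hx.2 k (Nat.lt_succ_self k)
    have h2 := cellCnt_succ_le hc k ⌊(3 : ℝ) ^ (k + 1) * x⌋
    have h3 := floor_pow_sub k 1 x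
    rw [pow_one] at h3
    rw [← h3] at h2
    simp only [crowded, Set.mem_ofPred_eq, not_le] at h1
    omega

lemma volume_cell (k : ℕ) (j : ℤ) :
    volume {y : ℝ | ⌊3 ^ k * y⌋ = j} = ENNReal.ofReal (3⁻¹ ^ k) := by
  have : {y : ℝ | ⌊3 ^ k * y⌋ = j} = (fun y : ℝ => 3 ^ k * y) ⁻¹' Set.Ico (j : ℝ) (j + 1) := by
    ext y
    simp only [Set.mem_ofPred_eq, Int.floor_eq_iff, Set.mem_preimage, Set.mem_Ico]
  rw [this, Real.volume_preimage_mul_left (by positivity), Real.volume_Ico]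
  simp

lemma sum_volume_firstAt_le (L n : ℕ) :
    ∑ k ∈ Finset.range (n + 1), volume (firstAt (crowded c L) k) ≤
      3 * volume {x | ∃ k ≤ n, L ≤ cnt c k x} := by
  have hm : ∀ k, MeasurableSet (firstAt (crowded c L) k) := fun k =>
    (IsCellular.firstAt (isCellular_crowded L) k).measurableSet
  have hm' : ∀ k, MeasurableSet (firstAt (full c L) k) := fun k =>
    (IsCellular.firstAt (isCellular_full L) k).measurableSet
  rw [← measure_biUnion_finset (fun i _ j _ hij => pairwise_disjoint_firstAt _ hij)
    (fun k _ => hm k)]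
  have hsub : ⋃ k ∈ Finset.range (n + 1), firstAt (crowded c L) k ⊆
      ⋃ k ∈ Finset.range (n + 1), ⋃ s ∈ Finset.Icc (-1 : ℤ) 1,
        (fun x : ℝ => x + s * 3⁻¹ ^ k) ⁻¹' firstAt (full c L) k := by
    intro x hx
    simp only [Set.mem_iUnion, Finset.mem_range] at hx
    obtain ⟨i, hi, hx⟩ := hx
    obtain ⟨s, hs, hfull⟩ := exists_le_cnt_of_le_cellCnt hx.1
    rw [abs_le] at hs
    have hy0 : (3 : ℝ) ^ i * (x + s * 3⁻¹ ^ i) = 3 ^ i * x + s := by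
      rw [inv_pow]; field_simp
    have hy : x + s * 3⁻¹ ^ i ∈ full c L i := by
      intro z hz
      apply hfull
      rw [hz, hy0, Int.floor_add_intCast]
    obtain ⟨k, hk, hyk⟩ := exists_firstAt hy
    obtain ⟨d, rfl⟩ := Nat.exists_eq_add_of_le hk
    simp only [Set.mem_iUnion, Finset.mem_range, Finset.mem_Icc, Set.mem_preimage]
    have hf1 := floor_pow_sub k d x
    have hf2 := floor_pow_sub k d (x + s * 3⁻¹ ^ (k + d))
    rw [hy0, Int.floor_add_intCast] at hf2
    set a := ⌊(3 : ℝ) ^ (k + d) * x⌋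
    have h3 : (0 : ℤ) < 3 ^ d := by positivity
    have h31 : (1 : ℤ) ≤ 3 ^ d := h3
    have e1 : (a + s) / 3 ^ d ≤ a / 3 ^ d + 1 := by
      calc (a + s) / 3 ^ d ≤ (a + 1 * 3 ^ d) / 3 ^ d := Int.ediv_le_ediv h3 (by linarith [hs.2])
        _ = a / 3 ^ d + 1 := Int.add_mul_ediv_right _ _ h3.ne'
    have e2 : a / 3 ^ d + -1 ≤ (a + s) / 3 ^ d := by
      calc a / 3 ^ d + -1 = (a + (-1) * 3 ^ d) / 3 ^ d := (Int.add_mul_ediv_right _ _ h3.ne').symm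
        _ ≤ (a + s) / 3 ^ d := Int.ediv_le_ediv h3 (by linarith [hs.1])
    refine ⟨k, by omega, (a + s) / 3 ^ d - a / 3 ^ d, ⟨by linarith, by linarith⟩, ?_⟩
    refine IsCellular.firstAt (isCellular_full L) k ?_ hyk
    have h0 : (3 : ℝ) ^ k * (x + ((a + s) / 3 ^ d - a / 3 ^ d : ℤ) * 3⁻¹ ^ k) =
        3 ^ k * x + ((a + s) / 3 ^ d - a / 3 ^ d : ℤ) := by
      rw [inv_pow]; field_simp
    rw [h0, Int.floor_add_intCast, hf1, hf2]
    ring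
  refine (measure_mono hsub).trans ?_
  calc volume (⋃ k ∈ Finset.range (n + 1), ⋃ s ∈ Finset.Icc (-1 : ℤ) 1,
        (fun x : ℝ => x + s * 3⁻¹ ^ k) ⁻¹' firstAt (full c L) k)
      ≤ ∑ k ∈ Finset.range (n + 1), ∑ s ∈ Finset.Icc (-1 : ℤ) 1,
        volume ((fun x : ℝ => x + s * 3⁻¹ ^ k) ⁻¹' firstAt (full c L) k) :=
        (measure_biUnion_finset_le _ _).trans
          (Finset.sum_le_sum fun k _ => measure_biUnion_finset_le _ _)
    _ = 3 * ∑ k ∈ Finset.range (n + 1), volume (firstAt (full c L) k) := by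
        simp_rw [measure_preimage_add_right]
        rw [Finset.mul_sum]
        refine Finset.sum_congr rfl fun k _ => ?_
        rw [Finset.sum_const]
        simp
    _ = 3 * volume (⋃ k ∈ Finset.range (n + 1), firstAt (full c L) k) := by
        rw [measure_biUnion_finset (fun i _ j _ hij => pairwise_disjoint_firstAt _ hij)
          (fun k _ => hm' k)]
    _ ≤ 3 * volume {x | ∃ k ≤ n, L ≤ cnt c k x} := by
        gcongr
        intro x hx
        simp only [Set.mem_iUnion, Finset.mem_range] at hx
        obtain ⟨k, hk, hx⟩ := hx
        exact ⟨k, by omega, hx.1 x rfl⟩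

/-- The squared `L²` norm of the multiplicity function of level `n`. -/
def energy (c : Fin 3 → ℝ) (n : ℕ) : ℝ≥0∞ := ∫⁻ x, (cnt c n x : ℝ≥0∞) ^ 2

lemma energy_ne_top (n : ℕ) : energy c n ≠ ∞ := by
  have h : energy c n ≤ ∫⁻ x, (3 ^ n : ℕ) * (cnt c n x : ℝ≥0∞) := by
    refine lintegral_mono fun x => ?_
    rw [sq]
    gcongr
    exact (Finset.card_le_univ _).trans (by simp)
  rw [lintegral_const_mul _ (by fun_prop), lintegral_cnt] at h
  exact ne_top_of_le_ne_top (ENNReal.mul_ne_top (ENNReal.natCast_ne_top _) (by simp)) h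

lemma setLIntegral_firstAt_le (hc : ∀ i, |c i| ≤ 1) {L : ℕ} (hL : 1 ≤ L) (k j : ℕ) :
    ∫⁻ x in firstAt (crowded c L) k, (cnt c (k + j) x : ℝ≥0∞) ^ 2 ≤
      81 * L ^ 2 * energy c j * volume (firstAt (crowded c L) k) := by
  set B := firstAt (crowded c L) k with hB
  have hcell : IsCellular k B := IsCellular.firstAt (isCellular_crowded L) k
  have hBm : MeasurableSet B := hcell.measurableSet
  set M : (Fin k → Fin 3) → Set ℝ := fun w => {x : ℝ |
    (⌊3 ^ k * x⌋ : ℝ) - 1 ≤ 3 ^ k * pt c w ∧ 3 ^ k * pt c w ≤ (⌊3 ^ k * x⌋ : ℝ) + 2} with hM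
  have hMcell : ∀ w, IsCellular k (M w) := fun w x y hxy hx => by
    simpa only [hM, Set.mem_ofPred_eq, hxy] using hx
  have hw : ∀ w : Fin k → Fin 3, ∫⁻ x in B, (cnt c j (3 ^ k * (x - pt c w)) : ℝ≥0∞) ^ 2 ≤
      energy c j * volume (B ∩ M w) := by
    intro w
    by_cases h : (B ∩ M w).Nonempty
    · obtain ⟨x, hxB, hxM⟩ := h
      calc ∫⁻ x in B, (cnt c j (3 ^ k * (x - pt c w)) : ℝ≥0∞) ^ 2
          ≤ ∫⁻ x, (cnt c j (3 ^ k * (x - pt c w)) : ℝ≥0∞) ^ 2 := setLIntegral_le_lintegral _ _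
        _ = energy c j * ENNReal.ofReal (3⁻¹ ^ k) := by
            rw [lintegral_comp_affine (f := fun x => (cnt c j x : ℝ≥0∞) ^ 2) (by fun_prop),
              mul_comm, energy]
        _ = energy c j * volume {y : ℝ | ⌊3 ^ k * y⌋ = ⌊3 ^ k * x⌋} := by rw [volume_cell]
        _ ≤ energy c j * volume (B ∩ M w) := by
            gcongr
            exact fun y hy => ⟨hcell (Eq.symm hy) hxB, hMcell w (Eq.symm hy) hxM⟩
    · rw [setLIntegral_congr_fun (g := fun _ => 0) hBm]
      · simp
      · intro x hx
        have hx' : x ∉ M w := fun hxM => h ⟨x, hx, hxM⟩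
        have : cnt c j (3 ^ k * (x - pt c w)) = 0 := by
          apply cnt_eq_zero hc
          by_contra hlt
          rw [not_lt, abs_le] at hlt
          have h1 := Int.floor_le (3 ^ k * x)
          have h2 := Int.lt_floor_add_one (3 ^ k * x)
          exact hx' ⟨by linarith, by linarith⟩
        simp [this]
  have hsum : ∑ w, volume (B ∩ M w) ≤ 9 * L * volume B := by
    calc ∑ w, volume (B ∩ M w) = ∑ w, ∫⁻ x in B, (M w).indicator 1 x := by
          refine Finset.sum_congr rfl fun w _ => ?_
          rw [lintegral_indicator_one (hMcell w).measurableSet,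
            Measure.restrict_apply (hMcell w).measurableSet, Set.inter_comm]
      _ = ∫⁻ x in B, ∑ w, (M w).indicator 1 x := by
          rw [lintegral_finsetSum _
            (fun w _ => measurable_one.indicator (hMcell w).measurableSet)]
      _ ≤ ∫⁻ x in B, (9 * L : ℝ≥0∞) := by
          refine setLIntegral_mono measurable_const fun x hx => ?_
          have h1 := cellCnt_le_of_firstAt hc hL hx
          rw [cellCnt, Finset.card_filter] at h1
          have h2 : ∑ w, (M w).indicator (1 : ℝ → ℝ≥0∞) x =
              ((∑ w : Fin k → Fin 3, if (⌊(3 : ℝ) ^ k * x⌋ : ℝ) - 1 ≤ 3 ^ k * pt c w ∧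
                3 ^ k * pt c w ≤ ⌊(3 : ℝ) ^ k * x⌋ + 2 then 1 else 0 : ℕ) : ℝ≥0∞) := by
            push_cast
            refine Finset.sum_congr rfl fun w _ => ?_
            simp only [Set.indicator_apply, hM, Set.mem_ofPred_eq, Pi.one_apply]
          rw [h2]
          exact_mod_cast h1
      _ = 9 * L * volume B := by rw [setLIntegral_const]
  calc ∫⁻ x in B, (cnt c (k + j) x : ℝ≥0∞) ^ 2
      ≤ ∫⁻ x in B, (9 * L : ℝ≥0∞) *
          ∑ w : Fin k → Fin 3, (cnt c j (3 ^ k * (x - pt c w)) : ℝ≥0∞) ^ 2 := by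
        refine setLIntegral_mono (by fun_prop) fun x hx => ?_
        have h1 := cnt_sq_le hc k j x
        have h2 := (cnt_le_cellCnt k x).trans (cellCnt_le_of_firstAt hc hL hx)
        exact_mod_cast h1.trans (Nat.mul_le_mul_right _ h2)
    _ = 9 * L * ∑ w : Fin k → Fin 3,
          ∫⁻ x in B, (cnt c j (3 ^ k * (x - pt c w)) : ℝ≥0∞) ^ 2 := by
        rw [lintegral_const_mul _ (by fun_prop), lintegral_finsetSum _ (fun w _ => by fun_prop)]
    _ ≤ 9 * L * ∑ w : Fin k → Fin 3, energy c j * volume (B ∩ M w) := by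
        gcongr with w
        exact hw w
    _ ≤ 9 * L * (energy c j * (9 * L * volume B)) := by
        rw [← Finset.mul_sum]
        gcongr
    _ = 81 * L ^ 2 * energy c j * volume B := by ring

theorem energy_le (hc : ∀ i, |c i| ≤ 1) {L N : ℕ} (hL : 1 ≤ L)
    (h : 486 * (L : ℝ≥0∞) ^ 2 * volume {x | ∃ k ≤ N, L ≤ cnt c k x} ≤ 1) {n : ℕ} (hn : n ≤ N) :
    energy c n ≤ 12 * L := by
  set S := (Finset.range (N + 1)).sup (energy c) with hS
  have hle : ∀ j ≤ N, energy c j ≤ S := fun j hj =>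
    Finset.le_sup (f := energy c) (Finset.mem_range.2 (by omega))
  have hStop : S ≠ ∞ := by
    refine ((Finset.sup_lt_iff (by simp)).2 fun j _ => ?_).ne
    exact (energy_ne_top j).lt_top
  have key : ∀ n ≤ N, energy c n ≤ 6 * L + 2⁻¹ * S := by
    intro n hn
    set U := ⋃ k ∈ Finset.range (n + 1), firstAt (crowded c L) k with hU
    have hm : ∀ k, MeasurableSet (firstAt (crowded c L) k) := fun k =>
      (IsCellular.firstAt (isCellular_crowded L) k).measurableSet
    have hUm : MeasurableSet U := Finset.measurableSet_biUnion _ fun k _ => hm k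
    rw [energy, ← lintegral_add_compl _ hUm, add_comm]
    gcongr
    · calc ∫⁻ x in Uᶜ, (cnt c n x : ℝ≥0∞) ^ 2 ≤ ∫⁻ x in Uᶜ, 3 * L * (cnt c n x : ℝ≥0∞) := by
            refine setLIntegral_mono (by fun_prop) fun x hx => ?_
            have h1 : x ∉ crowded c L n := by
              intro hxn
              obtain ⟨i, hi, hxi⟩ := exists_firstAt hxn
              exact hx (Set.mem_biUnion (Finset.mem_coe.2 (Finset.mem_range.2 (by omega))) hxi)
            simp only [crowded, Set.mem_ofPred_eq, not_le] at h1
            have h2 := (cnt_le_cellCnt n x).trans h1.le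
            rw [sq]
            gcongr
            exact_mod_cast h2
        _ ≤ ∫⁻ x, 3 * L * (cnt c n x : ℝ≥0∞) := setLIntegral_le_lintegral _ _
        _ = 6 * L := by
            rw [lintegral_const_mul _ (by fun_prop), lintegral_cnt]
            ring
    · calc ∫⁻ x in U, (cnt c n x : ℝ≥0∞) ^ 2
          = ∑ k ∈ Finset.range (n + 1),
            ∫⁻ x in firstAt (crowded c L) k, (cnt c n x : ℝ≥0∞) ^ 2 :=
            lintegral_biUnion_finset (fun i _ j _ hij => pairwise_disjoint_firstAt _ hij)
              (fun k _ => hm k) _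
        _ ≤ ∑ k ∈ Finset.range (n + 1), 81 * L ^ 2 * S * volume (firstAt (crowded c L) k) := by
            refine Finset.sum_le_sum fun k hk => ?_
            obtain ⟨j, rfl⟩ := Nat.exists_eq_add_of_le (Nat.lt_succ_iff.1 (Finset.mem_range.1 hk))
            refine (setLIntegral_firstAt_le hc hL k j).trans ?_
            gcongr
            exact hle j (by omega)
        _ ≤ 81 * L ^ 2 * S * (3 * volume {x | ∃ k ≤ N, L ≤ cnt c k x}) := by
            rw [← Finset.mul_sum]
            gcongr
            refine (sum_volume_firstAt_le L n).trans ?_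
            gcongr
        _ = 2⁻¹ * (486 * (L : ℝ≥0∞) ^ 2 * volume {x | ∃ k ≤ N, L ≤ cnt c k x}) * S := by
            have : (486 : ℝ≥0∞) = 2 * 243 := by norm_num
            have h2 : (2⁻¹ : ℝ≥0∞) * 486 = 243 := by
              rw [this, ← mul_assoc, ENNReal.inv_mul_cancel (by simp) (by simp), one_mul]
            rw [← mul_assoc, ← mul_assoc, ← mul_assoc, h2]
            ring
        _ ≤ 2⁻¹ * 1 * S := by gcongr
        _ = 2⁻¹ * S := by rw [mul_one]
  have hS2 : S ≤ 6 * L + 2⁻¹ * S :=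
    Finset.sup_le fun j hj => key j (Nat.lt_succ_iff.1 (Finset.mem_range.1 hj))
  refine (hle n hn).trans ?_
  clear_value S
  clear hS hle key
  lift S to NNReal using hStop
  have h2 : (2⁻¹ : ℝ≥0∞) = ((2⁻¹ : NNReal) : ℝ≥0∞) := by simp
  rw [h2] at hS2
  norm_cast at hS2 ⊢
  have hS3 : (S : ℝ) ≤ 6 * L + 2⁻¹ * S := by exact_mod_cast hS2
  have hS4 : (S : ℝ) ≤ 12 * L := by linarith
  exact_mod_cast hS4

/-- The exponential sum `∑ e^{i x p}` over the points `p` of level `n`. -/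
def expSum (c : Fin 3 → ℝ) (n : ℕ) (x : ℝ) : ℂ :=
  ∑ w : Fin n → Fin 3, Complex.exp (Complex.I * (x * pt c w : ℝ))

/-- The trigonometric polynomial `∑ e^{i t c}` of the generating translations. -/
def symbol (c : Fin 3 → ℝ) (t : ℝ) : ℂ := ∑ i, Complex.exp (Complex.I * (t * c i : ℝ))

lemma continuous_expSum (n : ℕ) : Continuous (expSum c n) := by
  unfold expSum
  fun_prop

lemma expSum_eq_prod (n : ℕ) (x : ℝ) :
    expSum c n x = ∏ i ∈ Finset.range n, symbol c (3⁻¹ ^ (i + 1) * x) := by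
  rw [Finset.prod_range]
  simp only [symbol]
  rw [Finset.prod_univ_sum, Fintype.piFinset_univ, expSum]
  refine Finset.sum_congr rfl fun w _ => ?_
  rw [← Complex.exp_sum, pt, Finset.mul_sum]
  push_cast
  rw [Finset.mul_sum]
  congr 1
  refine Finset.sum_congr rfl fun i _ => ?_
  ring

lemma le_norm_integral_exp {r x : ℝ} (hr : 0 < r) (hx : |x| * r ≤ 1) :
    r ≤ ‖∫ y in (-r)..r, Complex.exp (Complex.I * (x * y : ℝ))‖ := by
  have hre : (∫ y in (-r)..r, Complex.exp (Complex.I * (x * y : ℝ))).re =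
      ∫ y in (-r)..r, Real.cos (x * y) := by
    have hint : IntervalIntegrable (fun y : ℝ => Complex.exp (Complex.I * (x * y : ℝ))) volume
        (-r) r := Continuous.intervalIntegrable (by fun_prop) _ _
    have h2 := Complex.reCLM.intervalIntegral_comp_comm hint
    simp only [Complex.reCLM_apply] at h2
    rw [← h2]
    congr 1
    funext y
    rw [mul_comm, Complex.exp_ofReal_mul_I_re]
  calc r = ∫ y in (-r)..r, (1 / 2 : ℝ) := by
        rw [intervalIntegral.integral_const, smul_eq_mul]; ring
    _ ≤ ∫ y in (-r)..r, Real.cos (x * y) := by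
        refine intervalIntegral.integral_mono_on (by linarith) (by simp)
          (Continuous.intervalIntegrable (by fun_prop) _ _) fun y hy => ?_
        have h1 := Real.one_sub_sq_div_two_le_cos (x := x * y)
        have h2 : |x * y| ≤ 1 := by
          rw [abs_mul]
          exact (mul_le_mul_of_nonneg_left (abs_le.2 hy) (abs_nonneg _)).trans hx
        have h3 : (x * y) ^ 2 ≤ 1 := (sq_le_one_iff_abs_le_one _).2 h2
        linarith
    _ = (∫ y in (-r)..r, Complex.exp (Complex.I * (x * y : ℝ))).re := hre.symm
    _ ≤ _ := Complex.re_le_norm _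

lemma integral_exp_mul_cnt (hc : ∀ i, |c i| ≤ 1) (n : ℕ) (x : ℝ) :
    ∫ y in (-Real.pi)..Real.pi, Complex.exp (Complex.I * (x * y : ℝ)) * (cnt c n y : ℂ) =
      expSum c n x *
        ∫ y in (-(3 : ℝ)⁻¹ ^ n)..(3⁻¹ ^ n), Complex.exp (Complex.I * (x * y : ℝ)) := by
  have hpi := Real.pi_gt_three
  set r : ℝ := 3⁻¹ ^ n with hr
  have hr0 : 0 < r := by positivity
  have hr1 : r ≤ 1 := pow_le_one₀ (by norm_num) (by norm_num)
  have hr3 : (3 : ℝ) ^ n * r = 1 := by rw [hr, ← mul_pow]; norm_num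
  set e : ℝ → ℂ := fun y => Complex.exp (Complex.I * (x * y : ℝ)) with he
  have hec : Continuous e := by fun_prop
  have h1 : ∀ y, e y * (cnt c n y : ℂ) =
      ∑ w : Fin n → Fin 3, (Set.Icc (pt c w - r) (pt c w + r)).indicator e y := by
    intro y
    rw [cnt_eq_sum]
    push_cast
    rw [Finset.mul_sum]
    refine Finset.sum_congr rfl fun w _ => ?_
    have : |3 ^ n * (y - pt c w)| ≤ 1 ↔ y ∈ Set.Icc (pt c w - r) (pt c w + r) := by
      rw [← hr3, abs_mul, abs_of_pos (by positivity : (0 : ℝ) < 3 ^ n),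
        mul_le_mul_iff_right₀ (by positivity), abs_le, Set.mem_Icc]
      constructor <;> rintro ⟨h1, h2⟩ <;> constructor <;> linarith
    rw [Set.indicator_apply]
    by_cases hy : y ∈ Set.Icc (pt c w - r) (pt c w + r)
    · rw [if_pos hy, if_pos (this.2 hy), mul_one]
    · rw [if_neg hy, if_neg (mt this.1 hy), mul_zero]
  have hint : ∀ w : Fin n → Fin 3,
      Integrable ((Set.Icc (pt c w - r) (pt c w + r)).indicator e) volume := fun w =>
    (integrable_indicator_iff measurableSet_Icc).2 (hec.continuousOn.integrableOn_compact isCompact_Icc)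
  change ∫ y in (-Real.pi)..Real.pi, e y * (cnt c n y : ℂ) = _
  simp_rw [h1]
  rw [intervalIntegral.integral_finsetSum fun w _ => (hint w).intervalIntegrable, expSum,
    Finset.sum_mul]
  refine Finset.sum_congr rfl fun w _ => ?_
  have hp := abs_le.1 (abs_pt_le hc w)
  have hsub : Set.Icc (pt c w - r) (pt c w + r) ⊆ Set.Ioc (-Real.pi) Real.pi := fun y hy =>
    ⟨by linarith [hy.1], by linarith [hy.2]⟩
  rw [intervalIntegral.integral_of_le (by linarith), setIntegral_indicator measurableSet_Icc,
    Set.inter_eq_right.2 hsub,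
    integral_Icc_eq_integral_Ioc, ← intervalIntegral.integral_of_le (by linarith)]
  have h2 := intervalIntegral.integral_comp_add_left (a := -r) (b := r) e (pt c w)
  rw [show pt c w + -r = pt c w - r by ring] at h2
  rw [← h2, ← intervalIntegral.integral_const_mul]
  congr 1
  funext y
  simp only [he]
  rw [← Complex.exp_add]
  congr 1
  push_cast
  ring

lemma integral_cnt_sq (hc : ∀ i, |c i| ≤ 1) (n : ℕ) :
    ∫ y in (-Real.pi)..Real.pi, (cnt c n y : ℝ) ^ 2 = (energy c n).toReal := by
  have hpi := Real.pi_gt_three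
  rw [intervalIntegral.integral_of_le (by linarith), setIntegral_eq_integral_of_forall_compl_eq_zero,
    integral_eq_lintegral_of_nonneg_ae (ae_of_all _ fun y => by positivity)
      (Measurable.aestronglyMeasurable (by fun_prop))]
  · congr 1
    refine lintegral_congr fun y => ?_
    rw [ENNReal.ofReal_pow (by positivity), ENNReal.ofReal_natCast]
  · intro y hy
    rw [cnt_eq_zero hc]
    · simp
    · by_contra h
      rw [not_lt, abs_le] at h
      exact hy ⟨by linarith, by linarith⟩

lemma sum_norm_expSum_sq_le (hc : ∀ i, |c i| ≤ 1) (n : ℕ) {s : ℝ} (hs0 : 0 ≤ s) (hs1 : s ≤ 1) :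
    ∑ l ∈ Finset.range (3 ^ n), ‖expSum c n (l + s)‖ ^ 2 ≤ 7 * (3 ^ n) ^ 2 * (energy c n).toReal := by
  have hpi := Real.pi_gt_three
  have hpi' := Real.pi_lt_d2
  have hab : -Real.pi < Real.pi := by linarith
  set r : ℝ := 3⁻¹ ^ n with hr
  have hr0 : 0 < r := by positivity
  have hr3 : (3 : ℝ) ^ n * r = 1 := by rw [hr, ← mul_pow]; norm_num
  set f : ℝ → ℂ := fun y => Complex.exp (Complex.I * (s * y : ℝ)) * (cnt c n y : ℂ) with hf
  have hnorm : ∀ y, ‖f y‖ = cnt c n y := fun y => by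
    rw [hf, norm_mul, mul_comm Complex.I, Complex.norm_exp_ofReal_mul_I, one_mul,
      Complex.norm_natCast]
  have hfm : Measurable f := by
    have : Measurable fun y => (cnt c n y : ℂ) := measurable_from_top.comp (measurable_cnt n)
    exact Measurable.mul (Continuous.measurable (by fun_prop)) this
  have hmem : MemLp f 2 (volume.restrict (Set.Ioc (-Real.pi) Real.pi)) := by
    refine MemLp.of_bound hfm.aestronglyMeasurable (3 ^ n) (ae_of_all _ fun y => ?_)
    rw [hnorm]
    exact_mod_cast (Finset.card_le_univ _).trans (by simp)
  have hsum := hasSum_sq_fourierCoeffOn hab hmem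
  have hcoeff : ∀ l : ℕ, l < 3 ^ n → r ^ 2 * ‖expSum c n (l + s)‖ ^ 2 / (2 * Real.pi) ^ 2 ≤
      ‖fourierCoeffOn hab f (-(l : ℤ))‖ ^ 2 := by
    intro l hl
    have h1 : ∫ y in (-Real.pi)..Real.pi,
        (fourier (-(-(l : ℤ))) : AddCircle (Real.pi - -Real.pi) → ℂ) y • f y =
        expSum c n (l + s) * ∫ y in (-r)..r, Complex.exp (Complex.I * ((l + s) * y : ℝ)) := by
      rw [hr, ← integral_exp_mul_cnt hc]
      congr 1
      funext y
      rw [hf, fourier_coe_apply, smul_eq_mul, ← mul_assoc, ← Complex.exp_add]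
      congr 2
      have : (Real.pi : ℂ) ≠ 0 := by exact_mod_cast Real.pi_ne_zero
      push_cast
      field_simp
      ring
    have h2 : r ≤ ‖∫ y in (-r)..r, Complex.exp (Complex.I * ((l + s) * y : ℝ))‖ := by
      refine le_norm_integral_exp hr0 ?_
      rw [abs_of_nonneg (by positivity), ← hr3]
      refine mul_le_mul_of_nonneg_right ?_ hr0.le
      have : ((l + 1 : ℕ) : ℝ) ≤ ((3 ^ n : ℕ) : ℝ) := by exact_mod_cast hl
      push_cast at this
      linarith
    rw [fourierCoeffOn_eq_integral, h1, norm_smul, norm_mul, Real.norm_of_nonneg (by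
      rw [sub_neg_eq_add]; positivity), sub_neg_eq_add, ← two_mul]
    have h3 : r ^ 2 * ‖expSum c n (l + s)‖ ^ 2 ≤ ‖expSum c n (l + s)‖ ^ 2 *
        ‖∫ y in (-r)..r, Complex.exp (Complex.I * ((l + s) * y : ℝ))‖ ^ 2 := by
      rw [mul_comm]
      gcongr
    refine (div_le_div_of_nonneg_right h3 (by positivity : 0 ≤ (2 * Real.pi) ^ 2)).trans_eq ?_
    ring
  have hle : ∑ l ∈ Finset.range (3 ^ n), ‖fourierCoeffOn hab f (-(l : ℤ))‖ ^ 2 ≤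
      (2 * Real.pi)⁻¹ * (energy c n).toReal := by
    have h1 := sum_le_hasSum ((Finset.range (3 ^ n)).map
      ⟨fun l : ℕ => -(l : ℤ), fun a b h => by simpa using h⟩) (fun i _ => by positivity) hsum
    rw [Finset.sum_map] at h1
    simp_rw [hnorm] at h1
    rw [integral_cnt_sq hc, smul_eq_mul, sub_neg_eq_add, ← two_mul] at h1
    exact h1
  have h3 := (Finset.sum_le_sum fun l hl => hcoeff l (Finset.mem_range.1 hl)).trans hle
  rw [← Finset.sum_div, ← Finset.mul_sum, div_le_iff₀ (by positivity)] at h3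
  set X := ∑ l ∈ Finset.range (3 ^ n), ‖expSum c n (l + s)‖ ^ 2
  have hE : 0 ≤ (energy c n).toReal := ENNReal.toReal_nonneg
  calc X = (3 ^ n) ^ 2 * (r ^ 2 * X) := by rw [← mul_assoc, ← mul_pow, hr3]; ring
    _ ≤ (3 ^ n) ^ 2 * ((2 * Real.pi)⁻¹ * (energy c n).toReal * (2 * Real.pi) ^ 2) := by gcongr
    _ = (2 * Real.pi) * (3 ^ n) ^ 2 * (energy c n).toReal := by field_simp
    _ ≤ 7 * (3 ^ n) ^ 2 * (energy c n).toReal := by gcongr; linarith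

theorem integral_norm_expSum_sq_le (hc : ∀ i, |c i| ≤ 1) (n : ℕ) :
    ∫ x in (0 : ℝ)..3 ^ n, ‖expSum c n x‖ ^ 2 ≤ 7 * (3 ^ n) ^ 2 * (energy c n).toReal := by
  have hcont : Continuous fun x => ‖expSum c n x‖ ^ 2 := (continuous_expSum n).norm.pow 2
  have h1 := intervalIntegral.sum_integral_adjacent_intervals (μ := volume)
    (f := fun x => ‖expSum c n x‖ ^ 2) (a := fun l : ℕ => (l : ℝ)) (n := 3 ^ n)
    (fun k _ => hcont.intervalIntegrable _ _)
  push_cast at h1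
  rw [← h1]
  have h2 : ∀ l : ℕ, ∫ x in (l : ℝ)..(l + 1), ‖expSum c n x‖ ^ 2 =
      ∫ s in (0 : ℝ)..1, ‖expSum c n (l + s)‖ ^ 2 := by
    intro l
    have := intervalIntegral.integral_comp_add_left (a := 0) (b := 1)
      (fun x => ‖expSum c n x‖ ^ 2) (l : ℝ)
    rw [this, add_zero]
  simp_rw [h2]
  have hc2 : ∀ l : ℕ, Continuous fun s : ℝ => ‖expSum c n (l + s)‖ ^ 2 := fun l =>
    hcont.comp (by fun_prop : Continuous fun s : ℝ => (l : ℝ) + s)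
  rw [← intervalIntegral.integral_finsetSum fun l _ => (hc2 l).intervalIntegrable _ _]
  calc ∫ s in (0 : ℝ)..1, ∑ l ∈ Finset.range (3 ^ n), ‖expSum c n (l + s)‖ ^ 2
      ≤ ∫ s in (0 : ℝ)..1, 7 * (3 ^ n) ^ 2 * (energy c n).toReal :=
        intervalIntegral.integral_mono_on zero_le_one
          ((continuous_finsetSum _ fun l _ => hc2 l).intervalIntegrable _ _) (by simp)
          fun s hs => sum_norm_expSum_sq_le hc n hs.1 hs.2
    _ = _ := by simp

/-- Lower bound for the mean square of an exponential sum, by averaging over all differences of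
two points of `[0, T]`. -/
theorem le_integral_norm_expSum_sq (n : ℕ) {T : ℝ} (hT : 0 ≤ T) :
    T * 3 ^ n / 2 ≤ ∫ x in (0 : ℝ)..T, ‖expSum c n x‖ ^ 2 := by
  have hcont : Continuous fun x => ‖expSum c n x‖ ^ 2 := (continuous_expSum n).norm.pow 2
  have hsq : ∀ x, ‖expSum c n x‖ ^ 2 =
      ∑ w : Fin n → Fin 3, ∑ v : Fin n → Fin 3, Real.cos (x * (pt c w - pt c v)) := by
    intro x
    have hre : (expSum c n x).re = ∑ w : Fin n → Fin 3, Real.cos (x * pt c w) := by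
      rw [expSum, Complex.re_sum]
      exact Finset.sum_congr rfl fun w _ => by rw [mul_comm, Complex.exp_ofReal_mul_I_re]
    have him : (expSum c n x).im = ∑ w : Fin n → Fin 3, Real.sin (x * pt c w) := by
      rw [expSum, Complex.im_sum]
      exact Finset.sum_congr rfl fun w _ => by rw [mul_comm, Complex.exp_ofReal_mul_I_im]
    rw [Complex.sq_norm, Complex.normSq_apply, hre, him, Finset.sum_mul_sum, Finset.sum_mul_sum,
      ← Finset.sum_add_distrib]
    refine Finset.sum_congr rfl fun w _ => ?_
    rw [← Finset.sum_add_distrib]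
    refine Finset.sum_congr rfl fun v _ => ?_
    rw [mul_sub, Real.cos_sub]
  have heven : ∀ x, ‖expSum c n (-x)‖ ^ 2 = ‖expSum c n x‖ ^ 2 := by
    intro x
    simp only [hsq, neg_mul, Real.cos_neg]
  have hcos : ∀ d y : ℝ, ∫ x in (0 : ℝ)..T, Real.cos ((x - y) * d) =
      Real.cos (y * d) * (∫ x in (0 : ℝ)..T, Real.cos (x * d)) +
        Real.sin (y * d) * ∫ x in (0 : ℝ)..T, Real.sin (x * d) := by
    intro d y
    rw [← intervalIntegral.integral_const_mul, ← intervalIntegral.integral_const_mul,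
      ← intervalIntegral.integral_add (Continuous.intervalIntegrable (by fun_prop) _ _)
        (Continuous.intervalIntegrable (by fun_prop) _ _)]
    congr 1
    funext x
    rw [sub_mul, Real.cos_sub]
    ring
  have hcos2 : ∀ d : ℝ, ∫ y in (0 : ℝ)..T, ∫ x in (0 : ℝ)..T, Real.cos ((x - y) * d) =
      (∫ x in (0 : ℝ)..T, Real.cos (x * d)) ^ 2 + (∫ x in (0 : ℝ)..T, Real.sin (x * d)) ^ 2 := by
    intro d
    simp_rw [hcos]
    rw [intervalIntegral.integral_add (Continuous.intervalIntegrable (by fun_prop) _ _)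
        (Continuous.intervalIntegrable (by fun_prop) _ _), intervalIntegral.integral_mul_const,
        intervalIntegral.integral_mul_const]
    ring
  have hinner : ∀ y ∈ Set.Icc (0 : ℝ) T, ∫ x in (0 : ℝ)..T, ‖expSum c n (x - y)‖ ^ 2 ≤
      2 * ∫ x in (0 : ℝ)..T, ‖expSum c n x‖ ^ 2 := by
    intro y hy
    have h1 := intervalIntegral.integral_comp_sub_right (a := 0) (b := T)
      (fun x => ‖expSum c n x‖ ^ 2) y
    have h2 : ∫ x in (-T)..0, ‖expSum c n x‖ ^ 2 = ∫ x in (0 : ℝ)..T, ‖expSum c n x‖ ^ 2 := by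
      have := intervalIntegral.integral_comp_neg (a := 0) (b := T) (fun x => ‖expSum c n x‖ ^ 2)
      rw [neg_zero] at this
      rw [← this]
      simp_rw [heven]
    rw [h1]
    calc ∫ x in (0 - y)..(T - y), ‖expSum c n x‖ ^ 2 ≤ ∫ x in (-T)..T, ‖expSum c n x‖ ^ 2 :=
          intervalIntegral.integral_mono_interval (by linarith [hy.2]) (by linarith)
            (by linarith [hy.1]) (ae_of_all _ fun x => by positivity)
            (hcont.intervalIntegrable _ _)
      _ = 2 * ∫ x in (0 : ℝ)..T, ‖expSum c n x‖ ^ 2 := by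
          rw [← intervalIntegral.integral_add_adjacent_intervals
            (hcont.intervalIntegrable (-T) 0) (hcont.intervalIntegrable 0 T), h2]
          ring
  have hcI : ∀ y : ℝ, ∫ x in (0 : ℝ)..T, ‖expSum c n (x - y)‖ ^ 2 =
      ∑ w : Fin n → Fin 3, ∑ v : Fin n → Fin 3,
        ∫ x in (0 : ℝ)..T, Real.cos ((x - y) * (pt c w - pt c v)) := by
    intro y
    simp_rw [hsq]
    rw [intervalIntegral.integral_finsetSum
      fun w _ => Continuous.intervalIntegrable (by fun_prop) _ _]
    refine Finset.sum_congr rfl fun w _ => ?_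
    rw [intervalIntegral.integral_finsetSum
      fun w _ => Continuous.intervalIntegrable (by fun_prop) _ _]
  have hc3 : ∀ d : ℝ, Continuous fun y : ℝ => ∫ x in (0 : ℝ)..T, Real.cos ((x - y) * d) := by
    intro d
    simp_rw [hcos]
    fun_prop
  have hlow : T ^ 2 * 3 ^ n ≤ ∫ y in (0 : ℝ)..T, ∫ x in (0 : ℝ)..T, ‖expSum c n (x - y)‖ ^ 2 := by
    simp_rw [hcI]
    rw [intervalIntegral.integral_finsetSum
      fun w _ => (continuous_finsetSum _ fun v _ => hc3 _).intervalIntegrable _ _]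
    have hdiag : ∀ w : Fin n → Fin 3, T ^ 2 ≤ ∫ y in (0 : ℝ)..T, ∑ v : Fin n → Fin 3,
        ∫ x in (0 : ℝ)..T, Real.cos ((x - y) * (pt c w - pt c v)) := by
      intro w
      rw [intervalIntegral.integral_finsetSum fun v _ => (hc3 _).intervalIntegrable _ _]
      simp_rw [hcos2]
      refine le_trans (le_of_eq ?_) (Finset.single_le_sum
        (f := fun v : Fin n → Fin 3 =>
          (∫ x in (0 : ℝ)..T, Real.cos (x * (pt c w - pt c v))) ^ 2 +
          (∫ x in (0 : ℝ)..T, Real.sin (x * (pt c w - pt c v))) ^ 2)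
        (fun v _ => by positivity) (Finset.mem_univ w))
      simp
    refine le_trans (le_of_eq ?_) (Finset.sum_le_sum fun w _ => hdiag w)
    simp [mul_comm]
  have hup : ∫ y in (0 : ℝ)..T, ∫ x in (0 : ℝ)..T, ‖expSum c n (x - y)‖ ^ 2 ≤
      ∫ y in (0 : ℝ)..T, 2 * ∫ x in (0 : ℝ)..T, ‖expSum c n x‖ ^ 2 := by
    refine intervalIntegral.integral_mono_on hT ?_ (by simp) hinner
    simp_rw [hcI]
    exact (continuous_finsetSum _ fun w _ =>
      continuous_finsetSum _ fun v _ => hc3 _).intervalIntegrable _ _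
  rw [intervalIntegral.integral_const, smul_eq_mul, sub_zero] at hup
  rcases hT.eq_or_lt with rfl | hT'
  · simp
  · have := hlow.trans hup
    have h4 : T * (T * 3 ^ n) ≤ T * (2 * ∫ x in (0 : ℝ)..T, ‖expSum c n x‖ ^ 2) := by
      linarith
    have h5 := le_of_mul_le_mul_left h4 hT'
    linarith

/-- The projections of the three vertices of the gasket to the direction `θ`. -/
def vertexProj (θ : ℝ) : Fin 3 → ℝ :=
  ![Real.cos (Real.pi / 2 - θ), Real.cos (-Real.pi / 6 - θ), Real.cos (7 * Real.pi / 6 - θ)]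

lemma abs_vertexProj_le (θ : ℝ) (i : Fin 3) : |vertexProj θ i| ≤ 1 := by
  fin_cases i <;> exact Real.abs_cos_le_one _

instance (θ : ℝ) (k : ℕ) : SFinite (stepMeasure θ k) := by
  unfold stepMeasure
  infer_instance

lemma lintegral_stepMeasure (θ : ℝ) (k : ℕ) {f : ℝ → ℝ≥0∞} (hf : Measurable f) :
    ∫⁻ y, f y ∂stepMeasure θ k = 3⁻¹ * ∑ i, f (3⁻¹ ^ k * vertexProj θ i) := by
  rw [stepMeasure, lintegral_smul_measure, lintegral_add_measure, lintegral_add_measure,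
    lintegral_dirac' _ hf, lintegral_dirac' _ hf, lintegral_dirac' _ hf, Fin.sum_univ_three]
  rfl

lemma lintegral_nu (θ : ℝ) (n : ℕ) {f : ℝ → ℝ≥0∞} (hf : Measurable f) :
    ∫⁻ y, f y ∂nu θ n = 3⁻¹ ^ n * ∑ w : Fin n → Fin 3, f (pt (vertexProj θ) w) := by
  induction n generalizing f with
  | zero =>
    rw [nu, lintegral_dirac' _ hf]
    simp [pt]
  | succ n ih =>
    rw [nu, Measure.lintegral_conv hf]
    have h1 : ∀ x, ∫⁻ y, f (x + y) ∂stepMeasure θ (n + 1) =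
        3⁻¹ * ∑ i, f (x + 3⁻¹ ^ (n + 1) * vertexProj θ i) := fun x =>
      lintegral_stepMeasure θ (n + 1) (hf.comp (measurable_const_add x))
    simp_rw [h1]
    rw [ih (by fun_prop), sum_append, ← Finset.mul_sum, ← mul_assoc, ← pow_succ]
    congr 1
    refine Finset.sum_congr rfl fun w _ => ?_
    refine Fintype.sum_equiv (Equiv.funUnique (Fin 1) (Fin 3)).symm _ _ fun i => ?_
    rw [pt_append]
    congr 2
    simp only [pt, Finset.univ_unique, Finset.sum_singleton, pow_succ]
    simp [mul_assoc]

lemma multiplicity_eq (n : ℕ) (θ x : ℝ) :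
    multiplicity n θ x = (1 / 2) * cnt (vertexProj θ) n x := by
  rw [multiplicity]
  congr 1
  have hm : Measurable fun y : ℝ => (3 : ℝ) ^ n *
      (Set.Icc (-(3 : ℝ)⁻¹ ^ n) ((3 : ℝ)⁻¹ ^ n)).indicator (fun _ => (1 : ℝ)) (x - y) :=
    ((measurable_const.indicator measurableSet_Icc).comp (measurable_const_sub x)).const_mul _
  have h0 : ∀ y : ℝ, 0 ≤ (3 : ℝ) ^ n *
      (Set.Icc (-(3 : ℝ)⁻¹ ^ n) ((3 : ℝ)⁻¹ ^ n)).indicator (fun _ => (1 : ℝ)) (x - y) := fun y =>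
    mul_nonneg (by positivity) (Set.indicator_nonneg (fun _ _ => zero_le_one) _)
  rw [integral_eq_lintegral_of_nonneg_ae (ae_of_all _ h0) hm.aestronglyMeasurable,
    lintegral_nu θ n hm.ennreal_ofReal, ENNReal.toReal_mul,
    ENNReal.toReal_sum fun w _ => ENNReal.ofReal_ne_top, cnt_eq_sum, Finset.mul_sum]
  push_cast
  refine Finset.sum_congr rfl fun w _ => ?_
  rw [ENNReal.toReal_ofReal (h0 _), ENNReal.toReal_pow, ENNReal.toReal_inv, ENNReal.toReal_ofNat,
    ← mul_assoc, ← mul_pow, inv_mul_cancel₀ (by norm_num), one_pow, one_mul, Set.indicator_apply]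
  have h3 : (3 : ℝ) ^ n * 3⁻¹ ^ n = 1 := by rw [← mul_pow]; norm_num
  have : |3 ^ n * (x - pt (vertexProj θ) w)| ≤ 1 ↔
      x - pt (vertexProj θ) w ∈ Set.Icc (-(3 : ℝ)⁻¹ ^ n) (3⁻¹ ^ n) := by
    rw [Set.mem_Icc, ← abs_le, ← h3, abs_mul, abs_of_pos (by positivity : (0 : ℝ) < 3 ^ n),
      mul_le_mul_iff_right₀ (by positivity)]
  simp only [this]

lemma maxMultiplicitySet_eq (K : ℝ) (N : ℕ) (θ : ℝ) :
    maxMultiplicitySet K N θ = {x | ∃ k ≤ N, ⌈2 * K⌉₊ ≤ cnt (vertexProj θ) k x} := by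
  ext x
  simp only [maxMultiplicitySet, maxMultiplicity, Set.mem_ofPred_eq, Finset.le_sup'_iff,
    Finset.mem_range, Nat.lt_succ_iff, Nat.ceil_le, multiplicity_eq]
  refine exists_congr fun k => and_congr_right fun _ => ?_
  constructor <;> intro h <;> linarith

/-- The `L²` norms of the multiplicity functions are controlled in the directions of the set. -/
theorem energy_le_of_mem_directionSet {K : ℝ} (hK : 4374 ≤ K) {N n : ℕ} (hn : n ≤ N) {θ : ℝ}
    (hθ : θ ∈ directionSet K N) : (energy (vertexProj θ) n).toReal ≤ 36 * K := by
  have hL : ((⌈2 * K⌉₊ : ℕ) : ℝ) ≤ 3 * K := by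
    have := (Nat.ceil_lt_add_one (by linarith : 0 ≤ 2 * K)).le
    linarith
  set L := ⌈2 * K⌉₊ with hLdef
  have hL1 : 1 ≤ L := Nat.one_le_ceil_iff.2 (by linarith)
  have h := hθ.2
  rw [maxMultiplicitySet_eq, ← hLdef] at h
  have h1 : 486 * (L : ℝ≥0∞) ^ 2 * volume {x | ∃ k ≤ N, L ≤ cnt (vertexProj θ) k x} ≤ 1 := by
    calc 486 * (L : ℝ≥0∞) ^ 2 * volume {x | ∃ k ≤ N, L ≤ cnt (vertexProj θ) k x}
        ≤ 486 * (L : ℝ≥0∞) ^ 2 * ENNReal.ofReal ((K ^ 3)⁻¹) := by gcongr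
      _ = ENNReal.ofReal (486 * (L : ℝ) ^ 2 * (K ^ 3)⁻¹) := by
          rw [ENNReal.ofReal_mul (by positivity), ENNReal.ofReal_mul (by positivity),
            ENNReal.ofReal_pow (by positivity), ENNReal.ofReal_natCast, ENNReal.ofReal_ofNat]
      _ ≤ 1 := by
          rw [ENNReal.ofReal_le_one, ← div_eq_mul_inv, div_le_one (by positivity)]
          calc 486 * (L : ℝ) ^ 2 ≤ 486 * (3 * K) ^ 2 := by gcongr
            _ = 4374 * K ^ 2 := by ring
            _ ≤ K * K ^ 2 := by gcongr
            _ = K ^ 3 := by ring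
  have h2 := ENNReal.toReal_mono (ENNReal.mul_ne_top (by simp) (ENNReal.natCast_ne_top _))
    (energy_le (abs_vertexProj_le θ) hL1 h1 hn)
  rw [ENNReal.toReal_mul, ENNReal.toReal_natCast, ENNReal.toReal_ofNat] at h2
  linarith

lemma abs_one_add_two_cos_le {a b d : ℝ} :
    |1 + 2 * Real.cos (b - a)| ≤ 3 * ‖Complex.exp (Complex.I * (d : ℝ)) +
      (Complex.exp (Complex.I * (a : ℝ)) + Complex.exp (Complex.I * (b : ℝ)))‖ := by
  set u : ℂ := Complex.exp (Complex.I * (a : ℝ)) + Complex.exp (Complex.I * (b : ℝ)) with hu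
  have hn : ∀ t : ℝ, ‖Complex.exp (Complex.I * (t : ℝ))‖ = 1 := fun t => by
    rw [mul_comm, Complex.norm_exp_ofReal_mul_I]
  have hre : u.re = Real.cos a + Real.cos b := by
    rw [hu, Complex.add_re, mul_comm, Complex.exp_ofReal_mul_I_re, mul_comm,
      Complex.exp_ofReal_mul_I_re]
  have him : u.im = Real.sin a + Real.sin b := by
    rw [hu, Complex.add_im, mul_comm, Complex.exp_ofReal_mul_I_im, mul_comm,
      Complex.exp_ofReal_mul_I_im]
  have hsq : ‖u‖ ^ 2 = 2 + 2 * Real.cos (b - a) := by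
    rw [Complex.sq_norm, Complex.normSq_apply, hre, him, Real.cos_sub]
    linarith [Real.sin_sq_add_cos_sq a, Real.sin_sq_add_cos_sq b]
  have hle : ‖u‖ ≤ 2 := (norm_add_le _ _).trans (by rw [hn, hn]; norm_num)
  have h1 : |‖u‖ - 1| ≤ ‖Complex.exp (Complex.I * (d : ℝ)) + u‖ := by
    have := abs_norm_sub_norm_le u (-Complex.exp (Complex.I * (d : ℝ)))
    rwa [norm_neg, hn, sub_neg_eq_add, add_comm u] at this
  have h2 : 1 + 2 * Real.cos (b - a) = (‖u‖ + 1) * (‖u‖ - 1) := by linarith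
  rw [h2, abs_mul, abs_of_nonneg (by positivity)]
  exact mul_le_mul (by linarith) h1 (abs_nonneg _) (by norm_num)

lemma abs_one_add_two_cos_le_symbol {i : Fin 3} (hi : i ≠ 0) (t : ℝ) :
    |1 + 2 * Real.cos (t * (c i - c 0))| ≤ 3 * ‖symbol c t‖ := by
  rw [symbol, Fin.sum_univ_three, mul_sub]
  obtain rfl | rfl : i = 1 ∨ i = 2 := by omega
  · refine (abs_one_add_two_cos_le (d := t * c 2)).trans_eq (congrArg (fun z => 3 * ‖z‖) ?_)
    ring
  · refine (abs_one_add_two_cos_le (d := t * c 1)).trans_eq (congrArg (fun z => 3 * ‖z‖) ?_)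
    ring

lemma prod_one_add_two_cos (m : ℕ) (a : ℝ) :
    (∏ s ∈ Finset.range m, (1 + 2 * Real.cos (3 ^ s * a))) * Real.sin (a / 2) =
      Real.sin (3 ^ m * a / 2) := by
  induction m with
  | zero => simp
  | succ m ih =>
    rw [Finset.prod_range_succ, mul_right_comm, ih,
      show (3 : ℝ) ^ (m + 1) * a / 2 = 3 * (3 ^ m * a / 2) by ring, Real.sin_three_mul,
      show (3 : ℝ) ^ m * a = 2 * (3 ^ m * a / 2) by ring, Real.cos_two_mul,
      show 2 * ((3 : ℝ) ^ m * a / 2) / 2 = 3 ^ m * a / 2 by ring]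
    have := Real.sin_sq_add_cos_sq (3 ^ m * a / 2)
    have h2 : Real.cos (3 ^ m * a / 2) ^ 2 = 1 - Real.sin (3 ^ m * a / 2) ^ 2 := by linarith
    rw [h2]
    ring

lemma expSum_add (q m : ℕ) (x : ℝ) :
    expSum c (q + m) x =
      expSum c q x * ∏ s ∈ Finset.range m, symbol c (3 ^ s * (3⁻¹ ^ (q + m) * x)) := by
  rw [expSum_eq_prod, expSum_eq_prod, Finset.prod_range_add]
  congr 1
  rw [← Finset.prod_range_reflect]
  refine Finset.prod_congr rfl fun i hi => ?_
  obtain ⟨d, rfl⟩ := Nat.exists_eq_add_of_lt (Finset.mem_range.1 hi)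
  congr 1
  rw [show i + d + 1 - 1 - i = d by omega, show q + (i + d + 1) = (q + d + 1) + i by ring,
    pow_add _ (q + d + 1) i, inv_pow, inv_pow]
  field_simp

/-- The telescoping lower bound for the new factors of the exponential sum. -/
lemma norm_expSum_mul_abs_sin_le {i : Fin 3} (hi : i ≠ 0) (q m : ℕ) (x : ℝ) :
    ‖expSum c q x‖ * (3⁻¹ ^ m * |Real.sin (3⁻¹ ^ q * x * (c i - c 0) / 2)|) ≤
      ‖expSum c (q + m) x‖ := by
  rw [expSum_add, norm_mul, norm_prod]
  refine mul_le_mul_of_nonneg_left ?_ (norm_nonneg _)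
  set y := (3 : ℝ)⁻¹ ^ (q + m) * x with hy
  have h1 : (3 : ℝ)⁻¹ ^ q * x * (c i - c 0) / 2 = 3 ^ m * (y * (c i - c 0)) / 2 := by
    rw [hy, pow_add, inv_pow, inv_pow]
    field_simp
  rw [h1, ← prod_one_add_two_cos, abs_mul, Finset.abs_prod]
  have h2 : (∏ s ∈ Finset.range m, |1 + 2 * Real.cos (3 ^ s * (y * (c i - c 0)))|) ≤
      ∏ s ∈ Finset.range m, (3 * ‖symbol c (3 ^ s * y)‖) := by
    refine Finset.prod_le_prod (fun s _ => abs_nonneg _) fun s _ => ?_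
    rw [← mul_assoc]
    exact abs_one_add_two_cos_le_symbol hi _
  rw [Finset.prod_mul_distrib, Finset.prod_const, Finset.card_range] at h2
  calc 3⁻¹ ^ m * ((∏ s ∈ Finset.range m, |1 + 2 * Real.cos (3 ^ s * (y * (c i - c 0)))|) *
        |Real.sin (y * (c i - c 0) / 2)|)
      ≤ 3⁻¹ ^ m * ((3 ^ m * ∏ s ∈ Finset.range m, ‖symbol c (3 ^ s * y)‖) * 1) := by
        gcongr
        exact Real.abs_sin_le_one _
    _ = ∏ s ∈ Finset.range m, ‖symbol c (3 ^ s * y)‖ := by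
        rw [mul_one, ← mul_assoc, ← mul_pow, inv_mul_cancel₀ (by norm_num), one_pow, one_mul]

lemma one_sub_sq_le_norm_symbol (hc : ∀ i, |c i| ≤ 1) (t : ℝ) :
    3 * (1 - t ^ 2 / 2) ≤ ‖symbol c t‖ := by
  refine le_trans ?_ (Complex.re_le_norm _)
  rw [symbol, Complex.re_sum]
  have h : ∀ i, 1 - t ^ 2 / 2 ≤ (Complex.exp (Complex.I * (t * c i : ℝ))).re := by
    intro i
    rw [mul_comm, Complex.exp_ofReal_mul_I_re]
    have h1 := Real.one_sub_sq_div_two_le_cos (x := t * c i)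
    have h2 : (c i) ^ 2 ≤ 1 := (sq_le_one_iff_abs_le_one _).2 (hc i)
    nlinarith [mul_le_mul_of_nonneg_left h2 (sq_nonneg t)]
  have := Finset.sum_le_sum fun i (_ : i ∈ Finset.univ) => h i
  rw [Finset.sum_const, Finset.card_univ, Fintype.card_fin, nsmul_eq_mul] at this
  exact_mod_cast this

/-- Later factors do not reduce the normalised exponential sum on `[-3ⁿ, 3ⁿ]` by more than half. -/
lemma norm_expSum_le_two_mul (hc : ∀ i, |c i| ≤ 1) (n d : ℕ) {x : ℝ} (hx : |x| ≤ 3 ^ n) :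
    3⁻¹ ^ n * ‖expSum c n x‖ ≤ 2 * (3⁻¹ ^ (n + d) * ‖expSum c (n + d) x‖) := by
  have key : (1 / 2 + (9 : ℝ)⁻¹ ^ d / 2) * (3⁻¹ ^ n * ‖expSum c n x‖) ≤
      3⁻¹ ^ (n + d) * ‖expSum c (n + d) x‖ := by
    induction d with
    | zero => norm_num
    | succ d ih =>
      set F := (3 : ℝ)⁻¹ ^ n * ‖expSum c n x‖ with hF
      have hF0 : 0 ≤ F := by positivity
      set t := (3 : ℝ)⁻¹ ^ (n + d + 1) * x with ht
      have ht2 : t ^ 2 ≤ 9⁻¹ ^ (d + 1) := by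
        have h3 : |t| ≤ 3⁻¹ ^ (d + 1) := by
          rw [ht, abs_mul, abs_of_pos (by positivity)]
          calc (3 : ℝ)⁻¹ ^ (n + d + 1) * |x| ≤ 3⁻¹ ^ (n + d + 1) * 3 ^ n := by gcongr
            _ = 3⁻¹ ^ (d + 1) * (3⁻¹ * 3) ^ n := by rw [mul_pow]; ring
            _ = 3⁻¹ ^ (d + 1) := by norm_num
        calc t ^ 2 = |t| ^ 2 := (sq_abs t).symm
          _ ≤ (3⁻¹ ^ (d + 1)) ^ 2 := by gcongr
          _ = 9⁻¹ ^ (d + 1) := by rw [← pow_mul, mul_comm, pow_mul]; norm_num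
      have h1 : ‖expSum c (n + (d + 1)) x‖ = ‖expSum c (n + d) x‖ * ‖symbol c t‖ := by
        rw [← add_assoc, expSum_eq_prod, Finset.prod_range_succ, norm_mul, ← expSum_eq_prod]
      have h2 := one_sub_sq_le_norm_symbol hc t
      set p := (9 : ℝ)⁻¹ ^ d with hp
      have hp0 : 0 < p := by positivity
      have hp1 : p ≤ 1 := pow_le_one₀ (by norm_num) (by norm_num)
      rw [pow_succ 9⁻¹ d, ← hp] at ht2 ⊢
      rw [h1]
      calc (1 / 2 + p * 9⁻¹ / 2) * F ≤ ((1 / 2 + p / 2) * F) * (1 - t ^ 2 / 2) := by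
            have : 1 / 2 + p * 9⁻¹ / 2 ≤ (1 / 2 + p / 2) * (1 - t ^ 2 / 2) := by nlinarith
            nlinarith
        _ ≤ (3⁻¹ ^ (n + d) * ‖expSum c (n + d) x‖) * (1 - t ^ 2 / 2) := by
            refine mul_le_mul_of_nonneg_right ih ?_
            nlinarith
        _ ≤ (3⁻¹ ^ (n + d) * ‖expSum c (n + d) x‖) * (3⁻¹ * ‖symbol c t‖) := by
            refine mul_le_mul_of_nonneg_left ?_ (by positivity)
            linarith
        _ = 3⁻¹ ^ (n + (d + 1)) * (‖expSum c (n + d) x‖ * ‖symbol c t‖) := by ring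
  have h0 : 0 ≤ (3 : ℝ)⁻¹ ^ n * ‖expSum c n x‖ := by positivity
  have h9 : (0 : ℝ) < 9⁻¹ ^ d := by positivity
  nlinarith

/-- The differences of the translations stay away from a common resonance up to height `R`. -/
def NonResonant (c : Fin 3 → ℝ) (δ R : ℝ) : Prop :=
  ∀ z : ℝ, 1 ≤ z → z ≤ R →
    δ ≤ |Real.sin (z * (c 1 - c 0) / 2)| ∨ δ ≤ |Real.sin (z * (c 2 - c 0) / 2)|

lemma le_integral_window (hc : ∀ i, |c i| ≤ 1) {E δ : ℝ} {q m N : ℕ} (hN : q + m ≤ N)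
    (hE : (energy c q).toReal ≤ E) (hm : 28 * E ≤ 3 ^ m) (hδ : 0 ≤ δ)
    (hnr : NonResonant c δ (3 ^ m)) :
    δ ^ 2 / (16 * 27 ^ m) ≤
      ∫ x in (3 ^ q : ℝ)..3 ^ (q + m), (3⁻¹ ^ N * ‖expSum c N x‖) ^ 2 := by
  have hcont : ∀ n, Continuous fun x => ‖expSum c n x‖ ^ 2 := fun n =>
    (continuous_expSum n).norm.pow 2
  have hcont' : Continuous fun x => (3⁻¹ ^ N * ‖expSum c N x‖) ^ 2 :=
    ((continuous_expSum N).norm.const_mul _).pow 2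
  have h31 : (1 : ℝ) ≤ 3 ^ q := one_le_pow₀ (by norm_num)
  have hqm : (3 : ℝ) ^ q ≤ 3 ^ (q + m) := pow_le_pow_right₀ (by norm_num) (by omega)
  have hpt : ∀ x ∈ Set.Icc ((3 : ℝ) ^ q) (3 ^ (q + m)),
      (2⁻¹ * 3⁻¹ ^ (q + m) * 3⁻¹ ^ m * δ) ^ 2 * ‖expSum c q x‖ ^ 2 ≤
        (3⁻¹ ^ N * ‖expSum c N x‖) ^ 2 := by
    intro x hx
    obtain ⟨d, rfl⟩ := Nat.exists_eq_add_of_le hN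
    have h1 := norm_expSum_le_two_mul hc (q + m) d (x := x)
      (by rw [abs_of_nonneg (by linarith [hx.1])]; exact hx.2)
    have hz1 : 1 ≤ 3⁻¹ ^ q * x := by
      rw [inv_pow, inv_mul_eq_div, le_div_iff₀ (by positivity), one_mul]
      exact hx.1
    have hz2 : 3⁻¹ ^ q * x ≤ 3 ^ m := by
      rw [inv_pow, inv_mul_eq_div, div_le_iff₀ (by positivity), ← pow_add, add_comm]
      exact hx.2
    have h2 : ‖expSum c q x‖ * (3⁻¹ ^ m * δ) ≤ ‖expSum c (q + m) x‖ := by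
      rcases hnr _ hz1 hz2 with h | h
      · refine le_trans ?_ (norm_expSum_mul_abs_sin_le (i := 1) (by decide) q m x)
        gcongr
      · refine le_trans ?_ (norm_expSum_mul_abs_sin_le (i := 2) (by decide) q m x)
        gcongr
    rw [← mul_pow]
    refine pow_le_pow_left₀ (by positivity) ?_ 2
    have h3 : (3 : ℝ)⁻¹ ^ (q + m) * (‖expSum c q x‖ * (3⁻¹ ^ m * δ)) ≤
        3⁻¹ ^ (q + m) * ‖expSum c (q + m) x‖ := by gcongr
    linarith
  have hup := integral_norm_expSum_sq_le hc q
  have hlow := le_integral_norm_expSum_sq (c := c) q (T := 3 ^ (q + m)) (by positivity)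
  have hsplit := intervalIntegral.integral_add_adjacent_intervals
    ((hcont q).intervalIntegrable (μ := volume) 0 (3 ^ q))
    ((hcont q).intervalIntegrable (μ := volume) (3 ^ q) (3 ^ (q + m)))
  have hmain : (3 ^ q) ^ 2 * 3 ^ m / 4 ≤
      ∫ x in (3 ^ q : ℝ)..3 ^ (q + m), ‖expSum c q x‖ ^ 2 := by
    have h4 : 7 * ((3 : ℝ) ^ q) ^ 2 * (energy c q).toReal ≤ 7 * (3 ^ q) ^ 2 * E := by gcongr
    have h5 : ((3 : ℝ) ^ q) ^ 2 * (28 * E) ≤ (3 ^ q) ^ 2 * 3 ^ m := by gcongr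
    rw [pow_add] at *
    nlinarith
  calc δ ^ 2 / (16 * 27 ^ m)
      = (2⁻¹ * 3⁻¹ ^ (q + m) * 3⁻¹ ^ m * δ) ^ 2 * ((3 ^ q) ^ 2 * 3 ^ m / 4) := by
        rw [show (27 : ℝ) = 3 ^ 3 by norm_num, ← pow_mul, mul_comm 3 m, pow_mul, inv_pow, inv_pow,
          pow_add]
        field_simp
        ring
    _ ≤ (2⁻¹ * 3⁻¹ ^ (q + m) * 3⁻¹ ^ m * δ) ^ 2 *
        ∫ x in (3 ^ q : ℝ)..3 ^ (q + m), ‖expSum c q x‖ ^ 2 := by gcongr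
    _ = ∫ x in (3 ^ q : ℝ)..3 ^ (q + m),
        (2⁻¹ * 3⁻¹ ^ (q + m) * 3⁻¹ ^ m * δ) ^ 2 * ‖expSum c q x‖ ^ 2 := by
        rw [intervalIntegral.integral_const_mul]
    _ ≤ _ := intervalIntegral.integral_mono_on hqm
        (((hcont q).const_mul _).intervalIntegrable _ _) (hcont'.intervalIntegrable _ _) hpt

theorem windows_le (hc : ∀ i, |c i| ≤ 1) {E δ : ℝ} {m l N : ℕ} (hN : m * l ≤ N)
    (hE : ∀ n ≤ N, (energy c n).toReal ≤ E) (hm : 28 * E ≤ 3 ^ m) (hδ : 0 ≤ δ)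
    (hnr : NonResonant c δ (3 ^ m)) :
    l * δ ^ 2 ≤ 112 * E * 27 ^ m := by
  have hcont : Continuous fun x => (3⁻¹ ^ N * ‖expSum c N x‖) ^ 2 :=
    ((continuous_expSum N).norm.const_mul _).pow 2
  have h1 := intervalIntegral.sum_integral_adjacent_intervals (μ := volume)
    (f := fun x => (3⁻¹ ^ N * ‖expSum c N x‖) ^ 2) (a := fun k : ℕ => (3 : ℝ) ^ (m * k)) (n := l)
    (fun k _ => hcont.intervalIntegrable _ _)
  have h2 : ∑ k ∈ Finset.range l, δ ^ 2 / (16 * 27 ^ m) ≤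
      ∑ k ∈ Finset.range l, ∫ x in (3 ^ (m * k) : ℝ)..3 ^ (m * (k + 1)),
        (3⁻¹ ^ N * ‖expSum c N x‖) ^ 2 := by
    refine Finset.sum_le_sum fun k hk => ?_
    have hk' : m * (k + 1) ≤ N := (Nat.mul_le_mul_left m (Finset.mem_range.1 hk)).trans hN
    rw [mul_add, mul_one] at hk' ⊢
    exact le_integral_window hc hk' (hE _ (by omega)) hm hδ hnr
  rw [h1, Finset.sum_const, Finset.card_range, nsmul_eq_mul] at h2
  have h3 : ∫ x in (3 ^ (m * 0) : ℝ)..3 ^ (m * l), (3⁻¹ ^ N * ‖expSum c N x‖) ^ 2 ≤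
      ∫ x in (0 : ℝ)..3 ^ N, (3⁻¹ ^ N * ‖expSum c N x‖) ^ 2 :=
    intervalIntegral.integral_mono_interval (by positivity)
      (pow_le_pow_right₀ (by norm_num) (Nat.zero_le _))
      (pow_le_pow_right₀ (by norm_num) hN) (ae_of_all _ fun x => by positivity)
      (hcont.intervalIntegrable _ _)
  have h4 : ∫ x in (0 : ℝ)..3 ^ N, (3⁻¹ ^ N * ‖expSum c N x‖) ^ 2 ≤ 7 * E := by
    simp_rw [mul_pow]
    rw [intervalIntegral.integral_const_mul]
    calc ((3 : ℝ)⁻¹ ^ N) ^ 2 * ∫ x in (0 : ℝ)..3 ^ N, ‖expSum c N x‖ ^ 2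
        ≤ (3⁻¹ ^ N) ^ 2 * (7 * (3 ^ N) ^ 2 * E) := by
          gcongr
          refine (integral_norm_expSum_sq_le hc N).trans ?_
          gcongr
          exact hE N le_rfl
      _ = 7 * E * ((3⁻¹ * 3) ^ N) ^ 2 := by rw [mul_pow]; ring
      _ = 7 * E := by norm_num
  have h5 := h2.trans (h3.trans h4)
  rw [← mul_div_assoc, div_le_iff₀ (by positivity)] at h5
  linarith

lemma exists_abs_sub_int_mul_pi_le (x : ℝ) :
    |x - round (x / Real.pi) * Real.pi| ≤ Real.pi / 2 * |Real.sin x| := by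
  have hpi := Real.pi_pos
  set k := round (x / Real.pi)
  have h1 : |x - k * Real.pi| ≤ Real.pi / 2 := by
    have h := abs_sub_round (x / Real.pi)
    have : x - k * Real.pi = (x / Real.pi - k) * Real.pi := by field_simp
    rw [this, abs_mul, abs_of_pos hpi]
    nlinarith
  have h2 := Real.mul_abs_le_abs_sin h1
  have h3 : |Real.sin (x - k * Real.pi)| = |Real.sin x| := by
    rw [Real.sin_sub_int_mul_pi, abs_mul, abs_zpow, abs_neg, abs_one, one_zpow, one_mul]
  rw [h3] at h2
  calc |x - k * Real.pi| = Real.pi / 2 * (2 / Real.pi * |x - k * Real.pi|) := by field_simp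
    _ ≤ _ := by gcongr

lemma volume_small_trig_le {X Y η : ℝ} (hη : 0 ≤ η) (hXY : 1 ≤ X ^ 2 + Y ^ 2) :
    volume {θ | θ ∈ Set.Ico 0 Real.pi ∧ |X * Real.cos θ + Y * Real.sin θ| ≤ η} ≤
      ENNReal.ofReal (30 * η) := by
  have hpi := Real.pi_pos
  set S := {θ | θ ∈ Set.Ico 0 Real.pi ∧ |X * Real.cos θ + Y * Real.sin θ| ≤ η} with hS
  rcases S.eq_empty_or_nonempty with h | ⟨θ₁, hθ₁⟩
  · rw [h]; simp
  have hsub : S ⊆ ⋃ k ∈ Finset.Icc (-1 : ℤ) 1, Metric.closedBall (θ₁ + k * Real.pi) (5 * η) := by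
    intro θ hθ
    set g := X * Real.cos θ + Y * Real.sin θ with hg
    set g₁ := X * Real.cos θ₁ + Y * Real.sin θ₁ with hg₁
    have hgle : |g| ≤ η := hθ.2
    have hgle₁ : |g₁| ≤ η := hθ₁.2
    have e1 : X * Real.sin (θ - θ₁) = g₁ * Real.sin θ - g * Real.sin θ₁ := by
      rw [Real.sin_sub]; ring
    have e2 : Y * Real.sin (θ - θ₁) = g * Real.cos θ₁ - g₁ * Real.cos θ := by
      rw [Real.sin_sub]; ring
    have b1 : |X * Real.sin (θ - θ₁)| ≤ 2 * η := by
      rw [e1]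
      refine (abs_sub _ _).trans ?_
      rw [abs_mul, abs_mul]
      nlinarith [Real.abs_sin_le_one θ, Real.abs_sin_le_one θ₁, abs_nonneg g, abs_nonneg g₁]
    have b2 : |Y * Real.sin (θ - θ₁)| ≤ 2 * η := by
      rw [e2]
      refine (abs_sub _ _).trans ?_
      rw [abs_mul, abs_mul]
      nlinarith [Real.abs_cos_le_one θ, Real.abs_cos_le_one θ₁, abs_nonneg g, abs_nonneg g₁]
    have b3 : |Real.sin (θ - θ₁)| ≤ 3 * η := by
      refine abs_le_of_sq_le_sq ?_ (by positivity)
      have c1 := sq_le_sq' (abs_le.1 b1).1 (abs_le.1 b1).2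
      have c2 := sq_le_sq' (abs_le.1 b2).1 (abs_le.1 b2).2
      have c3 := mul_le_mul_of_nonneg_right hXY (sq_nonneg (Real.sin (θ - θ₁)))
      nlinarith
    have b4 := exists_abs_sub_int_mul_pi_le (θ - θ₁)
    have hr : |(θ - θ₁) / Real.pi| < 1 := by
      rw [abs_div, abs_of_pos hpi, div_lt_one hpi, abs_lt]
      constructor <;> linarith [hθ.1.1, hθ.1.2, hθ₁.1.1, hθ₁.1.2]
    have hk : |(round ((θ - θ₁) / Real.pi) : ℝ)| < 2 := by
      have := abs_sub_round ((θ - θ₁) / Real.pi)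
      rw [abs_le] at this
      rw [abs_lt] at hr ⊢
      constructor <;> linarith
    rw [abs_lt] at hk
    have hk1 : (-2 : ℤ) < round ((θ - θ₁) / Real.pi) := by exact_mod_cast hk.1
    have hk2 : round ((θ - θ₁) / Real.pi) < (2 : ℤ) := by exact_mod_cast hk.2
    refine Set.mem_biUnion (x := round ((θ - θ₁) / Real.pi))
      (Finset.mem_coe.2 (Finset.mem_Icc.2 ⟨by omega, by omega⟩)) ?_
    rw [Metric.mem_closedBall, Real.dist_eq, ← sub_sub]
    refine b4.trans ?_
    have := Real.pi_lt_d2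
    nlinarith [abs_nonneg (Real.sin (θ - θ₁))]
  refine (measure_mono hsub).trans ((measure_biUnion_finset_le _ _).trans ?_)
  simp_rw [Real.volume_closedBall]
  rw [Finset.sum_const, nsmul_eq_mul, ← ENNReal.ofReal_natCast,
    ← ENNReal.ofReal_mul (by positivity)]
  refine ENNReal.ofReal_le_ofReal (le_of_eq ?_)
  rw [Int.card_Icc, show ((1 : ℤ) + 1 - -1).toNat = 3 from rfl]
  push_cast
  ring

lemma vertexProj_one_sub (θ : ℝ) : vertexProj θ 1 - vertexProj θ 0 =
    √3 / 2 * Real.cos θ - 3 / 2 * Real.sin θ := by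
  have h : vertexProj θ 1 - vertexProj θ 0 =
    Real.cos (-Real.pi / 6 - θ) - Real.cos (Real.pi / 2 - θ) := rfl
  rw [h, Real.cos_pi_div_two_sub, show -Real.pi / 6 - θ = -(Real.pi / 6 + θ) by ring,
    Real.cos_neg, Real.cos_add, Real.cos_pi_div_six, Real.sin_pi_div_six]
  ring

lemma vertexProj_two_sub (θ : ℝ) : vertexProj θ 2 - vertexProj θ 0 =
    -(√3 / 2 * Real.cos θ) - 3 / 2 * Real.sin θ := by
  have h : vertexProj θ 2 - vertexProj θ 0 =
    Real.cos (7 * Real.pi / 6 - θ) - Real.cos (Real.pi / 2 - θ) := rfl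
  rw [h, Real.cos_pi_div_two_sub,
    show 7 * Real.pi / 6 - θ = (Real.pi / 6 - θ) + Real.pi by ring,
    Real.cos_add_pi, Real.cos_sub, Real.cos_pi_div_six, Real.sin_pi_div_six]
  ring

theorem volume_resonant_le {δ : ℝ} (hδ : 0 ≤ δ) (hδ' : δ ≤ 1 / 10) {R : ℕ} (hR : 1 ≤ R) :
    volume {θ | θ ∈ Set.Ico 0 Real.pi ∧ ¬ NonResonant (vertexProj θ) δ R} ≤
      ENNReal.ofReal (2160 * R ^ 2 * δ) := by
  have hpi := Real.pi_gt_three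
  have hpi' := Real.pi_lt_d2
  have h3 : √3 ^ 2 = 3 := Real.sq_sqrt (by norm_num)
  set I := (Finset.Icc (-(R : ℤ)) R ×ˢ Finset.Icc (-(R : ℤ)) R).filter fun p => p ≠ 0 with hI
  set X : ℤ × ℤ → ℝ := fun p => √3 / 2 * (p.1 + p.2) with hX
  set Y : ℤ × ℤ → ℝ := fun p => 3 / 2 * (p.1 - p.2) with hY
  have hsub : {θ | θ ∈ Set.Ico 0 Real.pi ∧ ¬ NonResonant (vertexProj θ) δ R} ⊆
      ⋃ p ∈ I, {θ | θ ∈ Set.Ico 0 Real.pi ∧ |X p * Real.cos θ + Y p * Real.sin θ| ≤ 8 * δ} := by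
    rintro θ ⟨hθ, hres⟩
    simp only [NonResonant, not_forall, not_or, not_le] at hres
    obtain ⟨z, hz1, hzR, ha, hb⟩ := hres
    set a := vertexProj θ 1 - vertexProj θ 0 with haa
    set b := vertexProj θ 2 - vertexProj θ 0 with hbb
    have habs : ∀ i, |vertexProj θ i - vertexProj θ 0| ≤ 2 := fun i =>
      (abs_sub _ _).trans (by linarith [abs_vertexProj_le θ i, abs_vertexProj_le θ 0])
    have ha2 : |a| ≤ 2 := habs 1
    have hb2 : |b| ≤ 2 := habs 2
    have hab : 3 / 2 ≤ a ^ 2 + b ^ 2 := by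
      rw [haa, hbb, vertexProj_one_sub, vertexProj_two_sub]
      nlinarith [Real.sin_sq_add_cos_sq θ, sq_nonneg (Real.sin θ), sq_nonneg (Real.cos θ)]
    have hnear : ∀ t : ℝ, |t| ≤ 2 → |Real.sin (z * t / 2)| < δ →
        ∃ k : ℤ, |z * t / 2 - k * Real.pi| ≤ 2 * δ ∧ |(k : ℝ)| ≤ z := by
      intro t ht hs
      have h1 : |z * t / 2 - round (z * t / 2 / Real.pi) * Real.pi| ≤ 2 * δ := by
        refine (exists_abs_sub_int_mul_pi_le _).trans ?_
        nlinarith [abs_nonneg (Real.sin (z * t / 2))]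
      refine ⟨_, h1, ?_⟩
      set k := round (z * t / 2 / Real.pi)
      have h2 : |z * t / 2| ≤ z := by
        rw [abs_div, abs_mul, abs_of_nonneg (by linarith : 0 ≤ z), abs_two]
        nlinarith
      have h4 : |(k : ℝ)| * Real.pi ≤ 2 * z := by
        calc |(k : ℝ)| * Real.pi = |z * t / 2 - (z * t / 2 - k * Real.pi)| := by
              rw [sub_sub_cancel, abs_mul, abs_of_pos Real.pi_pos]
          _ ≤ |z * t / 2| + |z * t / 2 - k * Real.pi| := abs_sub _ _
          _ ≤ 2 * z := by linarith
      nlinarith [abs_nonneg (k : ℝ)]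
    obtain ⟨k, hk1, hk2⟩ := hnear a ha2 ha
    obtain ⟨l, hl1, hl2⟩ := hnear b hb2 hb
    have hint : ∀ j : ℤ, |(j : ℝ)| ≤ z → j ∈ Finset.Icc (-(R : ℤ)) R := by
      intro j hj
      have : |(j : ℝ)| ≤ ((R : ℤ) : ℝ) := hj.trans (by exact_mod_cast hzR)
      rw [← Int.cast_abs] at this
      exact Finset.mem_Icc.2 (abs_le.1 (by exact_mod_cast this))
    refine Set.mem_biUnion (x := (k, l)) (Finset.mem_coe.2 (Finset.mem_filter.2
      ⟨Finset.mem_product.2 ⟨hint k hk2, hint l hl2⟩, ?_⟩)) ⟨hθ, ?_⟩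
    · intro h0
      obtain ⟨rfl, rfl⟩ := Prod.mk_eq_zero.1 h0
      rw [Int.cast_zero, zero_mul, sub_zero] at hk1 hl1
      have c1 := sq_le_sq' (abs_le.1 hk1).1 (abs_le.1 hk1).2
      have c2 := sq_le_sq' (abs_le.1 hl1).1 (abs_le.1 hl1).2
      have c3 : 3 / 2 ≤ z ^ 2 * (a ^ 2 + b ^ 2) := by nlinarith
      nlinarith
    · have e1 : X (k, l) * Real.cos θ + Y (k, l) * Real.sin θ = l * a - k * b := by
        rw [haa, hbb, vertexProj_one_sub, vertexProj_two_sub]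
        simp only [hX, hY]
        ring
      have e2 : z * (l * a - k * b) =
          2 * (l * (z * a / 2 - k * Real.pi) - k * (z * b / 2 - l * Real.pi)) := by ring
      rw [e1]
      have e3 : z * |l * a - k * b| ≤ z * (8 * δ) := by
        calc z * |l * a - k * b| = |z * (l * a - k * b)| := by
              rw [abs_mul, abs_of_nonneg (by linarith : 0 ≤ z)]
          _ = 2 * |l * (z * a / 2 - k * Real.pi) - k * (z * b / 2 - l * Real.pi)| := by
              rw [e2, abs_mul, abs_two]
          _ ≤ 2 * (|(l : ℝ)| * |z * a / 2 - k * Real.pi| +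
                |(k : ℝ)| * |z * b / 2 - l * Real.pi|) := by
              rw [← abs_mul, ← abs_mul]
              gcongr
              exact abs_sub _ _
          _ ≤ 2 * (z * (2 * δ) + z * (2 * δ)) := by gcongr
          _ = z * (8 * δ) := by ring
      exact le_of_mul_le_mul_left e3 (by linarith)
  have hcard : (I.card : ℝ) ≤ 9 * R ^ 2 := by
    have h1 : I.card ≤ (2 * R + 1) * (2 * R + 1) := by
      refine (Finset.card_filter_le _ _).trans ?_
      rw [Finset.card_product, Int.card_Icc]
      have : ((R : ℤ) + 1 - -(R : ℤ)).toNat = 2 * R + 1 := by omega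
      rw [this]
    have h2 : (I.card : ℝ) ≤ (2 * R + 1) * (2 * R + 1) := by exact_mod_cast h1
    have h4 : (1 : ℝ) ≤ R := by exact_mod_cast hR
    nlinarith
  calc volume {θ | θ ∈ Set.Ico 0 Real.pi ∧ ¬ NonResonant (vertexProj θ) δ R}
      ≤ ∑ p ∈ I, volume {θ | θ ∈ Set.Ico 0 Real.pi ∧
          |X p * Real.cos θ + Y p * Real.sin θ| ≤ 8 * δ} :=
        (measure_mono hsub).trans (measure_biUnion_finset_le _ _)
    _ ≤ ∑ p ∈ I, ENNReal.ofReal (30 * (8 * δ)) := by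
        refine Finset.sum_le_sum fun p hp => volume_small_trig_le (by positivity) ?_
        have hp0 := (Finset.mem_filter.1 hp).2
        have h1 : (1 : ℤ) ≤ p.1 ^ 2 + p.2 ^ 2 := by
          by_contra hlt
          have h5 : p.1 ^ 2 + p.2 ^ 2 ≤ 0 := by omega
          refine hp0 (Prod.ext ?_ ?_)
          · exact pow_eq_zero_iff two_ne_zero |>.1
              (le_antisymm (by nlinarith [sq_nonneg p.2]) (sq_nonneg p.1))
          · exact pow_eq_zero_iff two_ne_zero |>.1
              (le_antisymm (by nlinarith [sq_nonneg p.1]) (sq_nonneg p.2))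
        have h2 : (1 : ℝ) ≤ (p.1 : ℝ) ^ 2 + (p.2 : ℝ) ^ 2 := by exact_mod_cast h1
        simp only [hX, hY]
        nlinarith [sq_nonneg ((p.1 : ℝ) - p.2)]
    _ = ENNReal.ofReal (I.card * (30 * (8 * δ))) := by
        rw [Finset.sum_const, nsmul_eq_mul, ← ENNReal.ofReal_natCast,
          ← ENNReal.ofReal_mul (by positivity)]
    _ ≤ ENNReal.ofReal (2160 * R ^ 2 * δ) := by
        refine ENNReal.ofReal_le_ofReal ?_
        nlinarith

end Gasket
end

theorem Gasket.le_of_le_volume_directionSet {K : ℝ} (hK : 4374 ≤ K) {N : ℕ}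
    (h : ENNReal.ofReal K⁻¹ ≤ volume (Gasket.directionSet K N)) :
    (N : ℝ) ≤ 2 * 3024 * 4032 * 4320 ^ 2 * 3024 ^ 7 * K ^ 11 := by
  have hK0 : 0 < K := by linarith
  obtain ⟨m', hm1, hm2⟩ := exists_nat_pow_near (x := 1008 * K) (y := 3) (by linarith) (by norm_num)
  set m := m' + 1 with hm
  have hm3 : (3 : ℝ) ^ m ≤ 3024 * K := by rw [hm, pow_succ]; linarith
  set R : ℝ := 3 ^ m with hR
  have hR0 : 0 < R := by positivity
  have hR1 : 1 ≤ R := by linarith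
  set δ : ℝ := (4320 * R ^ 2 * K)⁻¹ with hδ
  have hδ0 : 0 < δ := by positivity
  have hδ1 : δ ≤ 1 / 10 := by
    rw [hδ, one_div]
    refine inv_anti₀ (by norm_num) ?_
    have : 1 ≤ R ^ 2 := one_le_pow₀ hR1
    nlinarith
  obtain ⟨θ, hθE, hθ⟩ : ∃ θ ∈ Gasket.directionSet K N,
      Gasket.NonResonant (Gasket.vertexProj θ) δ R := by
    by_contra hcon
    push Not at hcon
    have h1 : volume (Gasket.directionSet K N) ≤ ENNReal.ofReal (2160 * R ^ 2 * δ) := by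
      have h2 := Gasket.volume_resonant_le hδ0.le hδ1 (R := 3 ^ m) (Nat.one_le_pow _ _ (by norm_num))
      rw [Nat.cast_pow, Nat.cast_ofNat, ← hR] at h2
      have h4 : Gasket.directionSet K N ⊆ {θ | θ ∈ Set.Ico 0 Real.pi ∧
          ¬ Gasket.NonResonant (Gasket.vertexProj θ) δ R} := fun θ hθ => ⟨hθ.1, hcon θ hθ⟩
      exact (measure_mono h4).trans h2
    have h3 : 2160 * R ^ 2 * δ < K⁻¹ := by
      have : 2160 * R ^ 2 * δ = K⁻¹ / 2 := by
        rw [hδ]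
        field_simp
        norm_num
      rw [this]
      exact half_lt_self (by positivity)
    exact absurd (h.trans h1)
      (not_le.2 ((ENNReal.ofReal_lt_ofReal_iff (by positivity)).2 h3))
  have hwin := Gasket.windows_le (Gasket.abs_vertexProj_le θ) (E := 36 * K) (δ := δ) (m := m)
    (l := N / m) (N := N) (Nat.mul_div_le N m)
    (fun n hn => Gasket.energy_le_of_mem_directionSet hK hn hθE) (by linarith) hδ0.le hθ
  have h27 : (27 : ℝ) ^ m = R ^ 3 := by
    rw [hR, ← pow_mul, mul_comm, pow_mul]; norm_num
  rw [h27] at hwin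
  have hl : ((N / m : ℕ) : ℝ) ≤ 4032 * 4320 ^ 2 * R ^ 7 * K ^ 3 := by
    have h1 : ((N / m : ℕ) : ℝ) = ((N / m : ℕ) * δ ^ 2) * (4320 * R ^ 2 * K) ^ 2 := by
      rw [mul_assoc, ← mul_pow, hδ, inv_mul_cancel₀ (by positivity), one_pow, mul_one]
    rw [h1]
    calc ((N / m : ℕ) * δ ^ 2) * (4320 * R ^ 2 * K) ^ 2
        ≤ (112 * (36 * K) * R ^ 3) * (4320 * R ^ 2 * K) ^ 2 := by gcongr
      _ = 4032 * 4320 ^ 2 * R ^ 7 * K ^ 3 := by ring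
  have hN : (N : ℝ) ≤ m * ((N / m : ℕ) + 1) := by
    have h1 : N < m * (N / m + 1) := Nat.lt_mul_div_succ N (by omega)
    exact_mod_cast h1.le
  have hmR : (m : ℝ) ≤ R := by
    have : m < 3 ^ m := Nat.lt_pow_self (by norm_num)
    rw [hR]
    exact_mod_cast this.le
  have hone : 1 ≤ 4032 * 4320 ^ 2 * (3024 * K) ^ 7 * K ^ 3 := by
    have h1 : 1 ≤ (3024 * K) ^ 7 := one_le_pow₀ (by linarith)
    have h2 : 1 ≤ K ^ 3 := one_le_pow₀ (by linarith)
    have h3 : (1 : ℝ) ≤ 4032 * 4320 ^ 2 := by norm_num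
    exact one_le_mul_of_one_le_of_one_le (one_le_mul_of_one_le_of_one_le h3 h1) h2
  calc (N : ℝ) ≤ m * ((N / m : ℕ) + 1) := hN
    _ ≤ (3024 * K) * (4032 * 4320 ^ 2 * (3024 * K) ^ 7 * K ^ 3 +
        4032 * 4320 ^ 2 * (3024 * K) ^ 7 * K ^ 3) := by
        refine mul_le_mul (hmR.trans hm3) (add_le_add (hl.trans ?_) hone) (by positivity)
          (by positivity)
        gcongr
    _ = 2 * 3024 * 4032 * 4320 ^ 2 * 3024 ^ 7 * K ^ 11 := by ring

theorem mainTheorem3 (ε₀ : ℝ) (hpos : 0 < ε₀) (hlt : ε₀ < 1 / 11) :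
    ∀ᶠ N : ℕ in atTop,
      volume (Gasket.directionSet ((N : ℝ) ^ ε₀) N) < ENNReal.ofReal ((N : ℝ) ^ (-ε₀)) := by
  have h1 : Tendsto (fun N : ℕ => (N : ℝ) ^ ε₀) atTop atTop :=
    (tendsto_rpow_atTop hpos).comp tendsto_natCast_atTop_atTop
  have h2 : Tendsto (fun N : ℕ => (N : ℝ) ^ (1 - 11 * ε₀)) atTop atTop :=
    (tendsto_rpow_atTop (by linarith)).comp tendsto_natCast_atTop_atTop
  filter_upwards [h1.eventually_ge_atTop 4374,
    h2.eventually_gt_atTop (2 * 3024 * 4032 * 4320 ^ 2 * 3024 ^ 7), eventually_gt_atTop 0]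
    with N hK hC hN
  by_contra hcon
  have hN0 : (0 : ℝ) < N := by exact_mod_cast hN
  rw [not_lt, Real.rpow_neg hN0.le] at hcon
  have hle := Gasket.le_of_le_volume_directionSet hK hcon
  have hpow : ((N : ℝ) ^ ε₀) ^ 11 = (N : ℝ) ^ (11 * ε₀) := by
    rw [← Real.rpow_natCast, ← Real.rpow_mul hN0.le, mul_comm]
    norm_num
  have hsplit : (N : ℝ) ^ (1 - 11 * ε₀) * (N : ℝ) ^ (11 * ε₀) = N := by
    rw [← Real.rpow_add hN0, sub_add_cancel, Real.rpow_one]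
  rw [hpow] at hle
  have hpos' : (0 : ℝ) < (N : ℝ) ^ (11 * ε₀) := Real.rpow_pos_of_pos hN0 _
  have := mul_lt_mul_of_pos_right hC hpos'
  linarith
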